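/- Let $\mathcal D=\{z\in\mathbb C:|z|<1\}$ with the measure $d\mu(z)=d^2z/(1-|z|^2)^2$, where $d^2z=dx\,dy$, and let $$k_0(z)=\frac{1+|z|^2}{1-|z|^2},\quad k_1(z)=\frac1{\mathrm i}\,\frac{z-\bar z}{1-|z|^2},\quad k_2(z)=\frac{z+\bar z}{1-|z|^2},\quad k_\pm=k_2\mp \mathrm i\,k_1 .$$ Let $\eta>1/2$. Let $\mathcal{FB}_\eta$ be the space of holomorphic $f$ on $\mathcal D$ that are square integrable for $\langle f|g\rangle=\frac{2\eta-1}{\pi}\int_{\mathcal D}\overline{f(z)}\,g(z)\,(1-|z|^2)^{2\eta-2}\,d^2z$, with orthonormal basis $e_n(z)=\sqrt{(2\eta)_n/n!}\;z^n$, $n\ge 0$. Let $\mathsf P e_n=(-1)^n e_n$, and for $a\in\mathcal D$ let $U^\eta(p(a))$ be the unitary operator $$(U^\eta(p(a))f)(z)=(1-|a|^2)^{\eta}(1-z\bar a)^{-2\eta} f\Big(\frac{z-a}{1-z\bar a}\Big).$$ For a real weight $w$ on $[0,1)$ suppose that $\mathsf M^{w;\eta}=2\int_{\mathcal D}w(|z|^2)\,U^\eta(p(z))\mathsf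 P\,d\mu(z)$ (weakly: its matrix elements in the basis $e_n$ are absolutely convergent integrals) is a bounded trace-class operator of trace $1$; put $\mathsf M^{w;\eta}(p(z))=U^\eta(p(z))\,\mathsf M^{w;\eta}\,U^\eta(p(z))^\dagger$ and, weakly, $\mathsf A^{w;\eta}_f=\frac{2\eta-1}{\pi}\int_{\mathcal D} f(z)\,\mathsf M^{w;\eta}(p(z))\,d\mu(z)$. For two such weights $w_1$ (quantization) and $w_2$ (lower symbol), the lower symbol of $\mathsf A^{w_1;\eta}_f$ is $$\check{\mathsf A}^{w_{12};\eta}_f(z)=\frac{2\eta-1}{\pi}\int_{\mathcal D} f(z')\,\mathrm{tr}\big(\mathsf M^{w_1;\eta}(p(z'))\,\mathsf M^{w_2;\eta}(p(z))\big)\,d\mu(z').$$ (1) If $\int_{\mathcal D}k_0(t)\,\big|\mathrm{tr}\big(\mathsf M^{w_1;\eta}(p(t))\,\mathsf M^{w_2;\eta}\big)\big|\,d\mu(t)<\infty$, then there is one real constant $\varkappa_{w_{12};\eta}$ such that, for all $a\in\{0,1,2,+,-\}$ and all $z\in\mathcal D$, the integral defining $\check{\mathsf A}^{w_{12};\eta}_{k_a}(z)$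 converges absolutely and $$\check{\mathsf A}^{w_{12};\eta}_{k_a}(z)=\varkappa_{w_{12};\eta}\,k_a(z).$$ Moreover, whenever the sum over $n$ and the integral in $\sum_n\langle e_n|\mathsf A^{w_1;\eta}_{k_a}\mathsf M^{w_2;\eta}(p(z))e_n\rangle$ converge absolutely together, this trace $\mathrm{tr}\big(\mathsf A^{w_1;\eta}_{k_a}\mathsf M^{w_2;\eta}(p(z))\big)$ also equals $\varkappa_{w_{12};\eta}\,k_a(z)$. (2) Let $\eta>1$ and $w_1(u)=w_2(u)=\frac{\eta}{\pi}(1-u)^{\eta+1}$ (Perelomov case). Then $\mathsf M^{w_1;\eta}$ exists with the properties above, the integrals for all $k_a$ and $z$ converge absolutely, and both the lower symbol and the trace $\sum_n\langle e_n|\mathsf A^{w_1;\eta}_{k_a}\mathsf M^{w_1;\eta}(p(z))e_n\rangle$ equal $\varkappa\,k_a(z)$ with $$\varkappa=\frac{\eta}{\eta-1}.$$ -/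

import Mathlib

open scoped ComplexConjugate ComplexInnerProductSpace

noncomputable section

namespace SU11

open MeasureTheory

/-- The open unit disk `{z : |z| < 1}`. -/
abbrev Disk : Type := ↥(Metric.ball (0 : ℂ) 1)

/-- The `SU(1,1)`-invariant measure `d²z / (1 - |z|²)²` on the disk,
where `d²z = dx dy` is Lebesgue measure. -/
def hypMeasure : Measure Disk :=
  (Measure.comap ((↑) : Disk → ℂ) volume).withDensity fun z => ENNReal.ofReal (((1 - ‖(z : ℂ)‖ ^ 2) ^ 2)⁻¹)

/-! ### The basic classical observables -/

/-- `k₀ = (1 + |z|²) / (1 - |z|²)`. -/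
def k0 (z : Disk) : ℂ := (1 + (‖(z : ℂ)‖ : ℂ) ^ 2) / (1 - (‖(z : ℂ)‖ : ℂ) ^ 2)

/-- `k₁ = (1 / i) (z - z̄) / (1 - |z|²)`. -/
def k1 (z : Disk) : ℂ :=
  (1 / Complex.I) * (((z : ℂ) - conj (z : ℂ)) / (1 - (‖(z : ℂ)‖ : ℂ) ^ 2))

/-- `k₂ = (z + z̄) / (1 - |z|²)`. -/
def k2 (z : Disk) : ℂ := ((z : ℂ) + conj (z : ℂ)) / (1 - (‖(z : ℂ)‖ : ℂ) ^ 2)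

/-- `k₊ = k₂ - i k₁ = 2 z̄ / (1 - |z|²)`. -/
def kPlus (z : Disk) : ℂ := k2 z - Complex.I * k1 z

/-- `k₋ = k₂ + i k₁ = 2 z / (1 - |z|²)`. -/
def kMinus (z : Disk) : ℂ := k2 z + Complex.I * k1 z

/-- The basic observables `k_a`, for `a = 0, 1, 2` and `a = +, -`. -/
def basicObservables : Set (Disk → ℂ) := {k0, k1, k2, kPlus, kMinus}

/-! ### The Fock-Bargmann space -/

/-- The holomorphic functions on the disk (extended by zero outside of it) that are square
integrable with respect to `(1 - |z|²)^(2η - 2) d²z`. -/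
def fbSubmodule (η : ℝ) : Submodule ℂ (ℂ → ℂ) where
  carrier := {f | DifferentiableOn ℂ f (Metric.ball 0 1) ∧ (∀ z ∉ Metric.ball (0 : ℂ) 1, f z = 0) ∧
    IntegrableOn (fun z => ‖f z‖ ^ 2 * (1 - ‖z‖ ^ 2) ^ (2 * η - 2)) (Metric.ball 0 1)}
  zero_mem' := by
    refine ⟨differentiableOn_const 0, fun _ _ => rfl, ?_⟩
    simp
  add_mem' := by
    rintro f g ⟨hf, hf0, hfi⟩ ⟨hg, hg0, hgi⟩
    refine ⟨hf.add hg, fun z hz => by simp [hf0 z hz, hg0 z hz], ?_⟩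
    refine ((hfi.add hgi).const_mul 2).mono' ?_ ?_
    · refine AEStronglyMeasurable.mul ?_ (by
        exact (by fun_prop : Measurable fun z : ℂ => (1 - ‖z‖ ^ 2) ^ (2 * η - 2)).aestronglyMeasurable)
      exact (((hf.add hg).continuousOn.norm.pow 2).aestronglyMeasurable measurableSet_ball)
    · filter_upwards [self_mem_ae_restrict measurableSet_ball] with z hz
      have hz1 : ‖z‖ < 1 := by simpa using hz
      have hw : 0 ≤ (1 - ‖z‖ ^ 2) ^ (2 * η - 2) :=
        Real.rpow_nonneg (by nlinarith [norm_nonneg z]) _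
      have hn : ‖f z + g z‖ ^ 2 ≤ 2 * (‖f z‖ ^ 2 + ‖g z‖ ^ 2) := by
        have h1 := norm_add_le (f z) (g z)
        nlinarith [norm_nonneg (f z + g z), sq_nonneg (‖f z‖ - ‖g z‖)]
      rw [Real.norm_of_nonneg (mul_nonneg (sq_nonneg _) hw)]
      have := mul_le_mul_of_nonneg_right hn hw
      simp only [Pi.add_apply]
      nlinarith [this]
  smul_mem' := by
    rintro c f ⟨hf, hf0, hfi⟩
    refine ⟨hf.const_smul c, fun z hz => by simp [hf0 z hz], ?_⟩
    refine (hfi.const_mul (‖c‖ ^ 2)).congr (Filter.Eventually.of_forall fun z => ?_)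
    simp only [Pi.smul_apply, smul_eq_mul, norm_mul]
    ring

/-- The Fock-Bargmann space `FB_η`; its inner product is put on it below. -/
def FB (η : ℝ) : Type := ↥(fbSubmodule η)

instance (η : ℝ) : AddCommGroup (FB η) := inferInstanceAs (AddCommGroup ↥(fbSubmodule η))
instance (η : ℝ) : Module ℂ (FB η) := inferInstanceAs (Module ℂ ↥(fbSubmodule η))

variable {η : ℝ}

instance : CoeFun (FB η) (fun _ => ℂ → ℂ) := ⟨fun f => f.1⟩

theorem FB.ext {f g : FB η} (h : ∀ z ∈ Metric.ball (0 : ℂ) 1, f z = g z) : f = g := by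
  refine Subtype.ext (funext fun z => ?_)
  by_cases hz : z ∈ Metric.ball (0 : ℂ) 1
  · exact h z hz
  · rw [f.2.2.1 z hz, g.2.2.1 z hz]

@[simp] theorem FB.add_apply (f g : FB η) (z : ℂ) : (f + g) z = f z + g z := rfl
@[simp] theorem FB.smul_apply (c : ℂ) (f : FB η) (z : ℂ) : (c • f) z = c * f z := rfl

/-- `⟨f | g⟩ = (2η - 1) / π ∫ conj (f z) g z (1 - |z|²)^(2η - 2) d²z`. -/
def fbInner (f g : FB η) : ℂ :=
  (((2 * η - 1) / Real.pi : ℝ) : ℂ) *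
    ∫ z in Metric.ball (0 : ℂ) 1, conj (f z) * g z * (((1 - ‖z‖ ^ 2) ^ (2 * η - 2) : ℝ) : ℂ)

theorem weight_nonneg {z : ℂ} (hz : z ∈ Metric.ball (0 : ℂ) 1) (s : ℝ) :
    0 ≤ (1 - ‖z‖ ^ 2) ^ s := by
  have hz1 : ‖z‖ < 1 := by simpa using hz
  exact Real.rpow_nonneg (by nlinarith [norm_nonneg z]) _

theorem integrableOn_inner (f g : FB η) :
    IntegrableOn (fun z => conj (f z) * g z * (((1 - ‖z‖ ^ 2) ^ (2 * η - 2) : ℝ) : ℂ))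
      (Metric.ball (0 : ℂ) 1) := by
  refine (f.2.2.2.add g.2.2.2).mono' ?_ ?_
  · refine AEStronglyMeasurable.mul (AEStronglyMeasurable.mul ?_ ?_) ?_
    · exact (Complex.continuous_conj.comp_continuousOn
        f.2.1.continuousOn).aestronglyMeasurable measurableSet_ball
    · exact g.2.1.continuousOn.aestronglyMeasurable measurableSet_ball
    · exact (Complex.measurable_ofReal.comp (by fun_prop)).aestronglyMeasurable
  · filter_upwards [self_mem_ae_restrict measurableSet_ball] with z hz
    have hw := weight_nonneg hz (2 * η - 2)
    simp only [norm_mul, RCLike.norm_conj, Complex.norm_real, Real.norm_of_nonneg hw,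
      Pi.add_apply]
    have : ‖f z‖ * ‖g z‖ ≤ ‖f z‖ ^ 2 + ‖g z‖ ^ 2 := by
      nlinarith [sq_nonneg (‖f z‖ - ‖g z‖), sq_nonneg ‖f z‖, sq_nonneg ‖g z‖]
    have := mul_le_mul_of_nonneg_right this hw
    linarith

theorem fbInner_self (f : FB η) :
    fbInner f f = (((2 * η - 1) / Real.pi *
      ∫ z in Metric.ball (0 : ℂ) 1, ‖f z‖ ^ 2 * (1 - ‖z‖ ^ 2) ^ (2 * η - 2) : ℝ) : ℂ) := by
  rw [fbInner, Complex.ofReal_mul, ← integral_complex_ofReal]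
  congr 2
  funext z
  rw [← Complex.normSq_eq_conj_mul_self, Complex.normSq_eq_norm_sq]
  push_cast
  rfl

variable [hη : Fact (1 / 2 < η)]

theorem fbConst_pos : 0 < (2 * η - 1) / Real.pi :=
  div_pos (by linarith [hη.out]) Real.pi_pos

instance fbCore : InnerProductSpace.Core ℂ (FB η) where
  inner := fbInner
  conj_inner_symm f g := by
    simp only [fbInner, map_mul, Complex.conj_ofReal, ← integral_conj, Complex.conj_conj]
    congr 2
    funext z
    ring
  re_inner_nonneg f := by
    rw [fbInner_self]
    simp only [RCLike.re_to_complex, Complex.ofReal_re]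
    exact mul_nonneg fbConst_pos.le
      (setIntegral_nonneg measurableSet_ball fun z hz =>
        mul_nonneg (sq_nonneg _) (weight_nonneg hz _))
  add_left f g h := by
    simp only [fbInner]
    rw [← mul_add, ← integral_add (integrableOn_inner f h) (integrableOn_inner g h)]
    congr 2
    funext z
    simp only [FB.add_apply, map_add]
    ring
  smul_left f g c := by
    simp only [fbInner]
    rw [mul_left_comm, ← integral_const_mul (conj c)]
    congr 2
    funext z
    simp only [FB.smul_apply, map_mul]
    ring
  definite f hf := by
    have hf' : fbInner f f = 0 := hf
    rw [fbInner_self, Complex.ofReal_eq_zero, mul_eq_zero] at hf'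
    replace hf' := hf'.resolve_left fbConst_pos.ne'
    rw [setIntegral_eq_zero_iff_of_nonneg_ae
      (by
        filter_upwards [self_mem_ae_restrict measurableSet_ball] with z hz
        exact mul_nonneg (sq_nonneg _) (weight_nonneg hz _)) f.2.2.2] at hf'
    have h0 : f.1 =ᵐ[volume.restrict (Metric.ball (0 : ℂ) 1)] (fun _ => (0 : ℂ)) := by
      filter_upwards [hf', self_mem_ae_restrict measurableSet_ball] with z hz hzb
      have hz1 : ‖z‖ < 1 := by simpa using hzb
      have hw : 0 < (1 - ‖z‖ ^ 2) ^ (2 * η - 2) :=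
        Real.rpow_pos_of_pos (by nlinarith [norm_nonneg z]) _
      have := (mul_eq_zero.1 hz).resolve_right hw.ne'
      simpa using this
    exact FB.ext (Measure.eqOn_open_of_ae_eq h0 Metric.isOpen_ball f.2.1.continuousOn
      continuousOn_const)

instance : NormedAddCommGroup (FB η) := fbCore.toNormedAddCommGroup
instance : InnerProductSpace ℂ (FB η) := .ofCore fbCore.toCore

theorem integrableOn_weight :
    IntegrableOn (fun z : ℂ => (1 - ‖z‖ ^ 2) ^ (2 * η - 2)) (Metric.ball (0 : ℂ) 1) := by
  have key := integrableOn_fun_norm_addHaar (E := ℂ) (F := ℝ) (volume : Measure ℂ)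
    (f := fun r : ℝ => (1 - r ^ 2) ^ (2 * η - 2)) (r := 1)
  rw [key, Complex.finrank_real_complex]
  have h1 : IntegrableOn (fun r : ℝ => (1 - r) ^ (2 * η - 2)) (Set.Ioo 0 1) := by
    have h := (intervalIntegral.intervalIntegrable_rpow' (a := 0) (b := 1)
      (r := 2 * η - 2) (by linarith [hη.out])).comp_sub_left 1
    simp only [sub_zero, sub_self] at h
    exact ((intervalIntegrable_iff_integrableOn_Ioo_of_le zero_le_one).1 h.symm)
  have h2 : ContinuousOn (fun r : ℝ => r * (1 + r) ^ (2 * η - 2)) (Set.Icc 0 1) := by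
    refine continuousOn_id.mul (ContinuousOn.rpow_const (by fun_prop) fun r hr => Or.inl ?_)
    have := hr.1
    positivity
  have h3 : IntegrableOn (fun r : ℝ => (r * (1 + r) ^ (2 * η - 2)) * (1 - r) ^ (2 * η - 2))
      (Set.Icc 0 1) :=
    IntegrableOn.continuousOn_mul h2 ((integrableOn_Icc_iff_integrableOn_Ioo).2 h1) isCompact_Icc
  refine (h3.mono_set Set.Ioo_subset_Icc_self).congr_fun (fun r hr => ?_) measurableSet_Ioo
  simp only [smul_eq_mul, Nat.add_one_sub_one, pow_one]
  rw [mul_assoc, ← Real.mul_rpow (by linarith [hr.1]) (by linarith [hr.2])]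
  ring_nf

/-- The orthonormal basis `e_n (z) = √((2η)_n / n!) z^n` of `FB η`, where
`(2η)_n = Γ(2η + n) / Γ(2η)`. -/
def e (η : ℝ) [hη : Fact (1 / 2 < η)] (n : ℕ) : FB η :=
  ⟨(Metric.ball (0 : ℂ) 1).indicator fun z =>
    ((Real.sqrt (Real.Gamma (2 * η + n) / Real.Gamma (2 * η) / n.factorial) : ℝ) : ℂ) * z ^ n, by
    refine ⟨?_, fun z hz => Set.indicator_of_notMem hz _, ?_⟩
    · refine DifferentiableOn.congr (f := fun z : ℂ =>
        ((Real.sqrt (Real.Gamma (2 * η + n) / Real.Gamma (2 * η) / n.factorial) : ℝ) : ℂ) * z ^ n)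
        (by fun_prop) fun z hz => Set.indicator_of_mem hz _
    · have hc : ContinuousOn (fun z : ℂ =>
          ‖((Real.sqrt (Real.Gamma (2 * η + n) / Real.Gamma (2 * η) / n.factorial) : ℝ) : ℂ)
            * z ^ n‖ ^ 2) (Metric.closedBall 0 1) := by fun_prop
      have hb := (integrableOn_weight (η := η))
      obtain ⟨C, hC⟩ := (isCompact_closedBall (0 : ℂ) 1).exists_bound_of_continuousOn hc
      refine (hb.const_mul C).mono' ?_ ?_
      · refine AEStronglyMeasurable.mul ?_ hb.aestronglyMeasurable
        refine ((hc.mono Metric.ball_subset_closedBall).aestronglyMeasurable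
          measurableSet_ball).congr ?_
        filter_upwards [self_mem_ae_restrict measurableSet_ball] with z hz
        rw [Set.indicator_of_mem hz]
      · filter_upwards [self_mem_ae_restrict measurableSet_ball] with z hz
        rw [Set.indicator_of_mem hz, norm_mul, Real.norm_of_nonneg (weight_nonneg hz _)]
        exact mul_le_mul_of_nonneg_right (hC z (Metric.ball_subset_closedBall hz))
          (weight_nonneg hz _)⟩

/-! ### The representation operators -/

/-- The action `p(a)⁻¹ · z = (z - a) / (1 - z ā)` on the disk. -/
def moebius (a z : ℂ) : ℂ := (z - a) / (1 - z * conj a)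

/-- The function `z ↦ (1 - |a|²)^η (1 - z ā)^(-2η) f ((z - a) / (1 - z ā))` on the disk. The power
is the principal one (`1 - z ā` has positive real part). -/
def repFun (η : ℝ) (a : ℂ) (f : ℂ → ℂ) : ℂ → ℂ :=
  (Metric.ball (0 : ℂ) 1).indicator fun z =>
    (((1 - ‖a‖ ^ 2) ^ η : ℝ) : ℂ) * (1 - z * conj a) ^ (((-2 * η : ℝ)) : ℂ) * f (moebius a z)

theorem re_den_pos {a z : ℂ} (ha : ‖a‖ < 1) (hz : ‖z‖ < 1) : 0 < (1 - z * conj a).re := by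
  have h1 : (z * conj a).re ≤ ‖z * conj a‖ := Complex.re_le_norm _
  rw [norm_mul, RCLike.norm_conj] at h1
  have : ‖z‖ * ‖a‖ < 1 := by nlinarith [norm_nonneg z, norm_nonneg a]
  simp only [Complex.sub_re, Complex.one_re]
  linarith

theorem den_ne_zero {a z : ℂ} (ha : ‖a‖ < 1) (hz : ‖z‖ < 1) : 1 - z * conj a ≠ 0 := fun h => by
  have := re_den_pos ha hz
  rw [h] at this
  simp at this

theorem one_sub_normSq_moebius {a z : ℂ} (ha : ‖a‖ < 1) (hz : ‖z‖ < 1) :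
    1 - ‖moebius a z‖ ^ 2 = (1 - ‖a‖ ^ 2) * (1 - ‖z‖ ^ 2) / ‖1 - z * conj a‖ ^ 2 := by
  have hd : ‖1 - z * conj a‖ ^ 2 ≠ 0 := pow_ne_zero 2 (norm_ne_zero_iff.2 (den_ne_zero ha hz))
  rw [moebius, norm_div, div_pow, eq_div_iff hd, sub_mul, div_mul_cancel₀ _ hd, one_mul]
  simp only [← Complex.normSq_eq_norm_sq, Complex.normSq_apply, Complex.sub_re, Complex.sub_im,
    Complex.mul_re, Complex.mul_im, Complex.conj_re, Complex.conj_im, Complex.one_re,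
    Complex.one_im]
  ring

theorem norm_moebius_lt {a z : ℂ} (ha : ‖a‖ < 1) (hz : ‖z‖ < 1) : ‖moebius a z‖ < 1 := by
  have h := one_sub_normSq_moebius ha hz
  have : 0 < (1 - ‖a‖ ^ 2) * (1 - ‖z‖ ^ 2) / ‖1 - z * conj a‖ ^ 2 := by
    have h1 : 0 < 1 - ‖a‖ ^ 2 := by nlinarith [norm_nonneg a]
    have h2 : 0 < 1 - ‖z‖ ^ 2 := by nlinarith [norm_nonneg z]
    have h3 : 0 < ‖1 - z * conj a‖ := norm_pos_iff.2 (den_ne_zero ha hz)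
    positivity
  nlinarith [norm_nonneg (moebius a z)]

theorem one_add_moebius {a z : ℂ} (ha : ‖a‖ < 1) (hz : ‖z‖ < 1) :
    1 - moebius a z * conj (-a) = (((1 - ‖a‖ ^ 2 : ℝ)) : ℂ) * (1 - z * conj a)⁻¹ := by
  have hd := den_ne_zero ha hz
  have hn : a * conj a = ((‖a‖ ^ 2 : ℝ) : ℂ) := by
    rw [Complex.mul_conj, Complex.normSq_eq_norm_sq]
  rw [moebius, map_neg]
  field_simp
  push_cast at hn ⊢
  linear_combination -hn

theorem moebius_neg_moebius {a z : ℂ} (ha : ‖a‖ < 1) (hz : ‖z‖ < 1) :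
    moebius (-a) (moebius a z) = z := by
  have hd := den_ne_zero ha hz
  have h1 := one_add_moebius ha hz
  have ha' : (((1 - ‖a‖ ^ 2 : ℝ)) : ℂ) ≠ 0 := by
    rw [Complex.ofReal_ne_zero]
    nlinarith [norm_nonneg a]
  have hn : a * conj a = ((‖a‖ ^ 2 : ℝ) : ℂ) := by
    rw [Complex.mul_conj, Complex.normSq_eq_norm_sq]
  rw [moebius, h1, div_eq_iff (mul_ne_zero ha' (inv_ne_zero hd)), moebius]
  field_simp
  push_cast at hn ⊢
  linear_combination (-z) * hn

theorem image_moebius {a : ℂ} (ha : ‖a‖ < 1) :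
    moebius a '' Metric.ball (0 : ℂ) 1 = Metric.ball (0 : ℂ) 1 := by
  ext z
  simp only [Set.mem_image, mem_ball_zero_iff]
  constructor
  · rintro ⟨x, hx, rfl⟩
    exact norm_moebius_lt ha hx
  · intro hz
    have ha' : ‖-a‖ < 1 := by rwa [norm_neg]
    refine ⟨moebius (-a) z, norm_moebius_lt ha' hz, ?_⟩
    simpa using moebius_neg_moebius ha' hz

theorem injOn_moebius {a : ℂ} (ha : ‖a‖ < 1) :
    Set.InjOn (moebius a) (Metric.ball (0 : ℂ) 1) := by
  intro x hx y hy h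
  rw [mem_ball_zero_iff] at hx hy
  rw [← moebius_neg_moebius ha hx, h, moebius_neg_moebius ha hy]

theorem hasDerivAt_moebius {a z : ℂ} (ha : ‖a‖ < 1) (hz : ‖z‖ < 1) :
    HasDerivAt (moebius a) ((((1 - ‖a‖ ^ 2 : ℝ)) : ℂ) / (1 - z * conj a) ^ 2) z := by
  have hd := den_ne_zero ha hz
  have hn : a * conj a = ((‖a‖ ^ 2 : ℝ) : ℂ) := by
    rw [Complex.mul_conj, Complex.normSq_eq_norm_sq]
  have h := ((hasDerivAt_id z).sub_const a).div
    (((hasDerivAt_id z).mul_const (conj a)).const_sub 1) hd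
  refine h.congr_deriv ?_
  simp only [id]
  push_cast at hn ⊢
  congr 1
  linear_combination -hn

/-- The change of variables `w = p(a)⁻¹ · z` turns the squared-norm density of `f` into that of
the transformed function. -/
theorem repFun_density (η : ℝ) {a z : ℂ} (ha : ‖a‖ < 1) (hz : ‖z‖ < 1) (f : ℂ → ℂ) :
    ‖repFun η a f z‖ ^ 2 * (1 - ‖z‖ ^ 2) ^ (2 * η - 2) =
      |((ContinuousLinearMap.toSpanSingleton ℂ
        ((((1 - ‖a‖ ^ 2 : ℝ)) : ℂ) / (1 - z * conj a) ^ 2)).restrictScalars ℝ).det| •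
      (‖f (moebius a z)‖ ^ 2 * (1 - ‖moebius a z‖ ^ 2) ^ (2 * η - 2)) := by
  have h1 : 0 < 1 - ‖a‖ ^ 2 := by nlinarith [norm_nonneg a]
  have h2 : 0 < 1 - ‖z‖ ^ 2 := by nlinarith [norm_nonneg z]
  have h3 : 0 < ‖1 - z * conj a‖ := norm_pos_iff.2 (den_ne_zero ha hz)
  have hdet : ((ContinuousLinearMap.toSpanSingleton ℂ
        ((((1 - ‖a‖ ^ 2 : ℝ)) : ℂ) / (1 - z * conj a) ^ 2)).restrictScalars ℝ).det =
      (1 - ‖a‖ ^ 2) ^ 2 * (‖1 - z * conj a‖ ^ 4)⁻¹ := by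
    simp only [ContinuousLinearMap.det, ContinuousLinearMap.coe_restrictScalars,
      LinearMap.det_restrictScalars, Algebra.norm_complex_eq]
    have hA : ‖(1 : ℂ) - (‖a‖ : ℂ) ^ 2‖ = 1 - ‖a‖ ^ 2 := by
      have h := Complex.norm_real (1 - ‖a‖ ^ 2)
      rw [Real.norm_of_nonneg h1.le] at h
      rw [← h]
      push_cast
      rfl
    simp [Complex.normSq_eq_norm_sq, hA]
    rw [← pow_mul, div_eq_mul_inv]
  have hzb : z ∈ Metric.ball (0 : ℂ) 1 := by simpa using hz
  rw [hdet, abs_of_nonneg (by positivity), one_sub_normSq_moebius ha hz, repFun,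
    Set.indicator_of_mem hzb]
  simp only [norm_mul, Complex.norm_real, Complex.norm_cpow_real, smul_eq_mul]
  rw [Real.norm_of_nonneg (Real.rpow_nonneg h1.le _)]
  set A := 1 - ‖a‖ ^ 2
  set B := 1 - ‖z‖ ^ 2
  set N := ‖1 - z * conj a‖
  set F := ‖f (moebius a z)‖
  rw [Real.div_rpow (by positivity) (by positivity), Real.mul_rpow h1.le h2.le]
  have e1 : A ^ (2 * η - 2) * A ^ 2 = (A ^ η) ^ 2 := by
    rw [← Real.rpow_natCast A 2, ← Real.rpow_add h1, ← Real.rpow_natCast (A ^ η) 2,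
      ← Real.rpow_mul h1.le]
    congr 1
    push_cast
    ring
  have e2 : (N ^ (-2 * η)) ^ 2 = ((N ^ 2) ^ (2 * η - 2))⁻¹ * (N ^ 4)⁻¹ := by
    rw [← Real.rpow_natCast N 2, ← Real.rpow_natCast N 4, ← Real.rpow_natCast (N ^ _) 2,
      ← Real.rpow_mul h3.le, ← Real.rpow_mul h3.le, ← Real.rpow_neg h3.le, ← Real.rpow_neg h3.le,
      ← Real.rpow_add h3]
    congr 1
    push_cast
    ring
  rw [mul_pow, mul_pow, e2, ← e1]
  field_simp

theorem hasFDerivWithinAt_moebius {a : ℂ} (ha : ‖a‖ < 1) : ∀ z ∈ Metric.ball (0 : ℂ) 1,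
    HasFDerivWithinAt (moebius a) ((ContinuousLinearMap.toSpanSingleton ℂ
        ((((1 - ‖a‖ ^ 2 : ℝ)) : ℂ) / (1 - z * conj a) ^ 2)).restrictScalars ℝ)
      (Metric.ball (0 : ℂ) 1) z := fun z hz =>
  ((hasDerivAt_moebius ha (by simpa using hz)).hasFDerivAt.restrictScalars ℝ).hasFDerivWithinAt

theorem repFun_mem {a : ℂ} (ha : ‖a‖ < 1) (f : FB η) : repFun η a f ∈ fbSubmodule η := by
  refine ⟨?_, fun z hz => Set.indicator_of_notMem hz _, ?_⟩
  · refine DifferentiableOn.congr (f := fun z : ℂ =>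
      (((1 - ‖a‖ ^ 2) ^ η : ℝ) : ℂ) * (1 - z * conj a) ^ (((-2 * η : ℝ)) : ℂ) * f (moebius a z))
      ?_ fun z hz => Set.indicator_of_mem hz _
    refine ((DifferentiableOn.cpow_const (by fun_prop) fun z hz => ?_).const_mul _).mul ?_
    · exact Or.inl (re_den_pos ha (by simpa using hz))
    · refine f.2.1.comp (fun z hz => ?_) fun z hz => ?_
      · exact (hasDerivAt_moebius ha (by simpa using hz)).differentiableAt.differentiableWithinAt
      · rw [mem_ball_zero_iff] at hz ⊢
        exact norm_moebius_lt ha hz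
  · have h := f.2.2.2
    rw [← image_moebius ha, integrableOn_image_iff_integrableOn_abs_det_fderiv_smul volume
      measurableSet_ball (hasFDerivWithinAt_moebius ha) (injOn_moebius ha)] at h
    exact h.congr_fun (fun z hz => (repFun_density η ha (by simpa using hz) f).symm)
      measurableSet_ball

theorem ofReal_mul_cpow {r : ℝ} (hr : 0 < r) {x : ℂ} (hx : x ≠ 0) (c : ℂ) :
    ((r : ℂ) * x) ^ c = (r : ℂ) ^ c * x ^ c := by
  have hr' : (r : ℂ) ≠ 0 := Complex.ofReal_ne_zero.2 hr.ne'
  rw [Complex.cpow_def_of_ne_zero (mul_ne_zero hr' hx), Complex.log_ofReal_mul hr hx,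
    Complex.ofReal_log hr.le, add_mul, Complex.exp_add, ← Complex.cpow_def_of_ne_zero hr',
    ← Complex.cpow_def_of_ne_zero hx]

theorem repFun_repFun_neg {a : ℂ} (ha : ‖a‖ < 1) (f : FB η) :
    repFun η a (repFun η (-a) f) = f := by
  funext z
  by_cases hz : z ∈ Metric.ball (0 : ℂ) 1
  · have hz' : ‖z‖ < 1 := by simpa using hz
    have hm : moebius a z ∈ Metric.ball (0 : ℂ) 1 := by
      simpa using norm_moebius_lt ha hz'
    have h1 : 0 < 1 - ‖a‖ ^ 2 := by nlinarith [norm_nonneg a]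
    have hd := den_ne_zero ha hz'
    have harg : (1 - z * conj a).arg ≠ Real.pi := by
      intro h
      have := Complex.arg_eq_pi_iff.1 h
      linarith [re_den_pos ha hz', this.1]
    rw [repFun, Set.indicator_of_mem hz, repFun, Set.indicator_of_mem hm, norm_neg,
      moebius_neg_moebius ha hz', one_add_moebius ha hz',
      ofReal_mul_cpow h1 (inv_ne_zero hd), Complex.inv_cpow _ _ harg]
    have hc : (1 - z * conj a) ^ (((-2 * η : ℝ)) : ℂ) ≠ 0 := by
      rw [Complex.cpow_def_of_ne_zero hd]
      exact Complex.exp_ne_zero _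
    have hr : (((1 - ‖a‖ ^ 2) ^ η : ℝ) : ℂ) * (((1 - ‖a‖ ^ 2) ^ η : ℝ) : ℂ) *
        ((1 - ‖a‖ ^ 2 : ℝ) : ℂ) ^ (((-2 * η : ℝ)) : ℂ) = 1 := by
      rw [← Complex.ofReal_cpow h1.le, ← Complex.ofReal_mul, ← Complex.ofReal_mul,
        ← Real.rpow_add h1, ← Real.rpow_add h1, ← Complex.ofReal_one]
      congr 1
      rw [show η + η + -2 * η = 0 by ring, Real.rpow_zero]
    calc _ = ((((1 - ‖a‖ ^ 2) ^ η : ℝ) : ℂ) * (((1 - ‖a‖ ^ 2) ^ η : ℝ) : ℂ) *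
        ((1 - ‖a‖ ^ 2 : ℝ) : ℂ) ^ (((-2 * η : ℝ)) : ℂ)) *
        ((1 - z * conj a) ^ (((-2 * η : ℝ)) : ℂ) *
          ((1 - z * conj a) ^ (((-2 * η : ℝ)) : ℂ))⁻¹) * f z := by ring
      _ = f z := by rw [hr, mul_inv_cancel₀ hc, one_mul, one_mul]
  · rw [repFun, Set.indicator_of_notMem hz, f.2.2.1 z hz]

/-- The unitary operator `U^η(p(a))` on `FB η`:
`(U^η(p(a)) f)(z) = (1 - |a|²)^η (1 - z ā)^(-2η) f ((z - a) / (1 - z ā))`. -/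
def U (η : ℝ) [hη : Fact (1 / 2 < η)] (a : Disk) : FB η ≃ₗᵢ[ℂ] FB η :=
  have ha : ‖(a : ℂ)‖ < 1 := mem_ball_zero_iff.1 a.2
  have ha' : ‖-(a : ℂ)‖ < 1 := by rwa [norm_neg]
  { toFun := fun f => ⟨repFun η a f, repFun_mem ha f⟩
    invFun := fun f => ⟨repFun η (-a) f, repFun_mem ha' f⟩
    map_add' := fun f g => by
      refine FB.ext fun z hz => ?_
      change repFun η a (fun z => f z + g z) z = repFun η a f z + repFun η a g z
      simp only [repFun, Set.indicator_of_mem hz]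
      ring
    map_smul' := fun c f => by
      refine FB.ext fun z hz => ?_
      change repFun η a (fun z => c * f z) z = c * repFun η a f z
      simp only [repFun, Set.indicator_of_mem hz]
      ring
    left_inv := fun f => Subtype.ext (by
      have := repFun_repFun_neg ha' f
      rwa [neg_neg] at this)
    right_inv := fun f => Subtype.ext (repFun_repFun_neg ha f)
    norm_map' := fun f => by
      have key : ∀ g : FB η, ‖g‖ ^ 2 = (2 * η - 1) / Real.pi *
          ∫ z in Metric.ball (0 : ℂ) 1, ‖g z‖ ^ 2 * (1 - ‖z‖ ^ 2) ^ (2 * η - 2) := fun g => by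
        have h := inner_self_eq_norm_sq (𝕜 := ℂ) g
        rw [← h]
        change Complex.re (fbInner g g) = _
        rw [fbInner_self, Complex.ofReal_re]
      rw [← sq_eq_sq₀ (norm_nonneg _) (norm_nonneg _), key, key]
      congr 1
      have h := integral_image_eq_integral_abs_det_fderiv_smul volume measurableSet_ball
        (hasFDerivWithinAt_moebius ha) (injOn_moebius ha)
        (fun z => ‖f z‖ ^ 2 * (1 - ‖z‖ ^ 2) ^ (2 * η - 2))
      rw [image_moebius ha] at h
      refine Eq.trans ?_ h.symm
      exact setIntegral_congr_fun measurableSet_ball fun z hz =>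
        repFun_density η ha (by simpa using hz) f }

/-- The parity operator `P = ∑ₙ (-1)^n |e_n⟩⟨e_n|`, that is, `(P f)(z) = f (-z)`. -/
def parity (η : ℝ) : FB η →ₗ[ℂ] FB η where
  toFun f := ⟨fun z => f (-z), by
    have hb : ∀ z : ℂ, -z ∈ Metric.ball (0 : ℂ) 1 ↔ z ∈ Metric.ball (0 : ℂ) 1 := fun z => by
      simp
    refine ⟨f.2.1.comp (by fun_prop) fun z hz => (hb z).2 hz,
      fun z hz => f.2.2.1 _ fun h => hz ((hb z).1 h), ?_⟩
    have h := f.2.2.2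
    rw [← integrable_indicator_iff measurableSet_ball] at h ⊢
    refine h.comp_neg.congr (Filter.Eventually.of_forall fun z => ?_)
    simp [Set.indicator]⟩
  map_add' _ _ := rfl
  map_smul' _ _ := rfl

theorem parity_e (n : ℕ) : parity η (e η n) = (-1 : ℂ) ^ n • e η n := by
  refine FB.ext fun z hz => ?_
  have hz' : -z ∈ Metric.ball (0 : ℂ) 1 := by simpa using hz
  change (e η n) (-z) = (-1 : ℂ) ^ n * (e η n) z
  simp only [e, Set.indicator_of_mem hz, Set.indicator_of_mem hz']
  rw [neg_pow]
  ring

/-! ### Traces, quantizers, quantization and lower symbols -/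

/-- Trace-class (equivalently, nuclear) operators: `T = ∑ₖ |y_k⟩⟨x_k|` with
`∑ₖ ‖x_k‖ ‖y_k‖ < ∞`. -/
def IsTraceClass {H : Type*} [NormedAddCommGroup H] [InnerProductSpace ℂ H] (T : H →L[ℂ] H) :
    Prop :=
  ∃ x y : ℕ → H, Summable (fun k => ‖x k‖ * ‖y k‖) ∧
    ∀ v, HasSum (fun k => inner ℂ (x k) v • y k) (T v)

/-- The trace `∑ₙ ⟨e_n | T e_n⟩` (meaningful for trace-class `T`). -/
def trace (T : FB η →L[ℂ] FB η) : ℂ := ∑' n, inner ℂ (e η n) (T (e η n))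

/-- `M` is the operator `M^{w;η} = 2 ∫ w(|z|²) U^η(p(z)) P d²z / (1 - |z|²)²` (its matrix elements
in the basis `e_n` are convergent integrals), and it is bounded and trace class with unit trace. -/
structure IsQuantizer (w : ℝ → ℝ) (M : FB η →L[ℂ] FB η) : Prop where
  integrable : ∀ m n, Integrable (fun z : Disk =>
    (w (‖(z : ℂ)‖ ^ 2) : ℂ) * inner ℂ (e η m) (U η z (parity η (e η n)))) hypMeasure
  inner_eq : ∀ m n, inner ℂ (e η m) (M (e η n)) =
    2 * ∫ z : Disk, (w (‖(z : ℂ)‖ ^ 2) : ℂ) * inner ℂ (e η m) (U η z (parity η (e η n)))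
      ∂hypMeasure
  traceClass : IsTraceClass M
  trace_eq_one : trace M = 1

/-- The transported operator `M(p(z)) = U^η(p(z)) M U^η(p(z))†`. -/
def transport (M : FB η →L[ℂ] FB η) (z : Disk) : FB η →L[ℂ] FB η :=
  (U η z : FB η →L[ℂ] FB η) ∘L M ∘L ((U η z).symm : FB η →L[ℂ] FB η)

/-- The matrix element `⟨φ | A_f ψ⟩` of the quantized observable
`A_f = (2η - 1) / π ∫ f(z) M(p(z)) d²z / (1 - |z|²)²`, which is understood weakly. -/
def quantizedForm (M : FB η →L[ℂ] FB η) (f : Disk → ℂ) (φ ψ : FB η) : ℂ :=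
  (((2 * η - 1) / Real.pi : ℝ) : ℂ) *
    ∫ z : Disk, f z * inner ℂ φ (transport M z ψ) ∂hypMeasure

/-- The integrand of the lower symbol at `z` of the quantization of `f`. -/
def symbolIntegrand (M₁ M₂ : FB η →L[ℂ] FB η) (f : Disk → ℂ) (z z' : Disk) : ℂ :=
  f z' * trace (transport M₁ z' ∘L transport M₂ z)

/-- The lower symbol at `z`, relative to `M₂`, of the operator `A_f` quantized with `M₁`:
`tr (A_f M₂(p(z))) = (2η - 1) / π ∫ f(z') tr (M₁(p(z')) M₂(p(z))) d²z' / (1 - |z'|²)²`. -/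
def lowerSymbol (M₁ M₂ : FB η →L[ℂ] FB η) (f : Disk → ℂ) (z : Disk) : ℂ :=
  (((2 * η - 1) / Real.pi : ℝ) : ℂ) * ∫ z' : Disk, symbolIntegrand M₁ M₂ f z z' ∂hypMeasure

/-- The double expression (sum over the basis in the trace of `A_f M₂(p(z))`, integral over the disk
in `A_f`) converges absolutely. -/
def TraceConvergesAbsolutely (M₁ M₂ : FB η →L[ℂ] FB η) (f : Disk → ℂ) (z : Disk) : Prop :=
  (∀ n, Integrable (fun z' : Disk =>
    f z' * inner ℂ (e η n) (transport M₁ z' (transport M₂ z (e η n)))) hypMeasure) ∧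
  Summable fun n => ∫ z' : Disk,
    ‖f z' * inner ℂ (e η n) (transport M₁ z' (transport M₂ z (e η n)))‖ ∂hypMeasure

/-- The trace of `A_f M₂(p(z))`, with `A_f` quantized by `M₁`, converges in the basis `e_n` and its
value is `c`: `∑ₙ ⟨e_n | A_f M₂(p(z)) e_n⟩ = c`. -/
def HasOperatorLowerSymbol (M₁ M₂ : FB η →L[ℂ] FB η) (f : Disk → ℂ) (z : Disk) (c : ℂ) : Prop :=
  HasSum (fun n => quantizedForm M₁ f (e η n) (transport M₂ z (e η n))) c

/-- The Perelomov weight `w(u) = (η / π) (1 - u)^(η + 1)`. -/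
def perelomovWeight (η : ℝ) (u : ℝ) : ℝ := η / Real.pi * (1 - u) ^ (η + 1)

end SU11

end

/-!
Both parts rest on covariance. A quantizer `M` is an integral of the operators `U(p(z)) P` against
a radial weight and the invariant measure, so rotating `z` shows that `M` is diagonal in the basis
`e_n`, with real diagonal (`IsQuantizer.isDiagonal`, `IsQuantizer.conj_inner`); in particular it
commutes with rotations. The composition law of the representation, `U(p(z))† U(p(z'))` being a
scalar times `U(p(p(z)⁻¹ · z'))` times a rotation (`exists_U_symm_U`), then shows that `tr
(M₁(p(z')) M₂(p(z)))` is the function `overlap M₁ M₂` of the relative position `p(z)⁻¹ · z'`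
(`trace_transport_comp_transport`). The overlap is real and invariant under rotations.

After a change of variables in the invariant measure, the lower symbol of `k_a` at `z` is the
integral of `k_a (p(z) · t)` against the overlap of `t`. Now `k_a (p(z) · t)` is `k_a(z) k₀(t)`
plus a combination of `t / (1 - |t|²)` and its conjugate (`isCovariantObservable`). These terms
are odd and integrate to zero, so the common factor is the integral of `k₀` against the overlap
(`symbolFactor`, `lowerSymbol_eq`). The operator trace has the same value by the exchange of sum
and integral.

Unitary invariance of the trace needs the basis `e_n` to be total. This is derived from the Taylor
expansion: integrals over disks of radius `ρ < 1` may be taken term by term, and `ρ → 1` gives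
Parseval's identity (`hasSum_norm_sq`), with no appeal to the completeness of the Fock-Bargmann
space.

For the Perelomov weight the quantizer is the projection `|e₀⟩⟨e₀|`
(`isQuantizer_groundProjection`): the diagonal matrix elements of `U(p(z)) P` are, up to the
factor `(1 - |z|²)^η`, Jacobi polynomials in `|z|²` that are orthogonal to constants for the
resulting weight, an instance of the Chu-Vandermonde sum. The overlap is then `(1 - |t|²)^(2η)`,
whose integral against `k₀` gives `η / (η - 1)`, and the same decay dominates the double series
and integral of the trace (`traceConvergesAbsolutely_groundProjection`).
-/

noncomputable section

namespace SU11

open MeasureTheory Filter Topology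

section

/-! ### Radial integrals over the disk -/

/-- Polar coordinates, followed by the substitution `u = r²`. -/
theorem integral_ball_comp_norm_sq (g : ℝ → ℝ) :
    ∫ z in Metric.ball (0 : ℂ) 1, g (‖z‖ ^ 2) = Real.pi * ∫ u in Set.Ioo (0 : ℝ) 1, g u := by
  have h1 : ∀ z : ℂ, (Metric.ball (0 : ℂ) 1).indicator (fun z => g (‖z‖ ^ 2)) z =
      (Set.Iio (1 : ℝ)).indicator (fun r => g (r ^ 2)) ‖z‖ := fun z => by
    by_cases hz : ‖z‖ < 1 <;> simp [Set.indicator, hz]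
  rw [← integral_indicator measurableSet_ball, funext h1,
    integral_fun_norm_addHaar (volume : Measure ℂ) ((Set.Iio (1 : ℝ)).indicator fun r => g (r ^ 2)),
    Complex.finrank_real_complex, measureReal_def, Complex.volume_ball,
    ← integral_indicator measurableSet_Ioo]
  have h2 := integral_comp_rpow_Ioi_of_pos (g := (Set.Ioo (0 : ℝ) 1).indicator g) (p := 2) two_pos
  have h3 : ∫ u, (Set.Ioo (0 : ℝ) 1).indicator g u =
      ∫ u in Set.Ioi (0 : ℝ), (Set.Ioo (0 : ℝ) 1).indicator g u := by
    rw [← integral_indicator measurableSet_Ioi, Set.indicator_indicator,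
      Set.inter_eq_right.2 Set.Ioo_subset_Ioi_self]
  have h4 : ∫ x in Set.Ioi (0 : ℝ), ((2 : ℝ) * x ^ ((2 : ℝ) - 1)) •
        (Set.Ioo (0 : ℝ) 1).indicator g (x ^ (2 : ℝ)) =
      ∫ x in Set.Ioi (0 : ℝ), 2 * (x ^ (2 - 1) • (Set.Iio (1 : ℝ)).indicator
        (fun r => g (r ^ 2)) x) := by
    refine setIntegral_congr_fun measurableSet_Ioi fun x hx => ?_
    have hx0 : (0 : ℝ) < x := hx
    have e1 : x ^ ((2 : ℝ) - 1) = x := by norm_num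
    have e2 : x ^ (2 : ℝ) = x ^ 2 := by norm_cast
    have e3 : (x ^ 2 < 1) ↔ x < 1 := by
      constructor <;> intro h <;> nlinarith
    simp only [e1, e2, Set.indicator, Set.mem_Ioo, Set.mem_Iio, e3, pow_pos hx0 2, true_and,
      smul_eq_mul]
    ring
  rw [h3, ← h2, h4, integral_const_mul]
  simp
  ring

theorem Gamma_add_nat_div_Gamma {x : ℝ} (hx : 0 < x) (n : ℕ) :
    Real.Gamma (x + n) / Real.Gamma x = (ascPochhammer ℝ n).eval x := by
  induction n with
  | zero => simp [(Real.Gamma_pos_of_pos hx).ne']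
  | succ n ih =>
    rw [ascPochhammer_succ_eval, ← ih, Nat.cast_succ, ← add_assoc,
      Real.Gamma_add_one (by positivity)]
    ring

theorem ascPochhammer_eval_eq_prod {R : Type*} [CommSemiring R] (x : R) (n : ℕ) :
    (ascPochhammer R n).eval x = ∏ j ∈ Finset.range n, (x + j) := by
  induction n with
  | zero => simp
  | succ n ih => rw [ascPochhammer_succ_eval, ih, Finset.prod_range_succ]

/-- The Beta integral `B(k + 1, s)` for natural `k`. -/
theorem integral_pow_mul_one_sub_rpow {s : ℝ} (hs : 0 < s) (k : ℕ) :
    ∫ u in Set.Ioo (0 : ℝ) 1, u ^ k * (1 - u) ^ (s - 1) =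
      k.factorial / (ascPochhammer ℝ (k + 1)).eval s := by
  have h := Complex.betaIntegral_eval_nat_add_one_right (u := (s : ℂ)) (by simpa using hs) k
  rw [Complex.betaIntegral_symm, Complex.betaIntegral,
    intervalIntegral.integral_of_le zero_le_one, integral_Ioc_eq_integral_Ioo] at h
  have h2 : ∫ u in Set.Ioo (0 : ℝ) 1, (u : ℂ) ^ ((k : ℂ) + 1 - 1) * (1 - (u : ℂ)) ^ ((s : ℂ) - 1) =
      ((∫ u in Set.Ioo (0 : ℝ) 1, u ^ k * (1 - u) ^ (s - 1) : ℝ) : ℂ) := by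
    rw [← integral_complex_ofReal]
    refine setIntegral_congr_fun measurableSet_Ioo fun u hu => ?_
    have : 0 ≤ 1 - u := by linarith [hu.2]
    simp only [add_sub_cancel_right, Complex.cpow_natCast]
    push_cast [Complex.ofReal_cpow this]
    rfl
  rw [h2] at h
  rw [ascPochhammer_eval_eq_prod]
  exact_mod_cast h

theorem measurable_radial (s : ℝ) : Measurable fun z : ℂ => (1 - ‖z‖ ^ 2) ^ s := by fun_prop

theorem integrableOn_one_sub_norm_sq_rpow {s : ℝ} (hs : -1 < s) :
    IntegrableOn (fun z : ℂ => (1 - ‖z‖ ^ 2) ^ s) (Metric.ball (0 : ℂ) 1) := by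
  have : Fact (1 / 2 < (s + 2) / 2) := ⟨by linarith⟩
  have h := integrableOn_weight (η := (s + 2) / 2)
  simpa [mul_div_cancel₀] using h

/-! ### The monomial basis -/

theorem setIntegral_ball_rotate (ω : Circle) (r : ℝ) (F : ℂ → ℂ) :
    ∫ z in Metric.ball (0 : ℂ) r, F (ω * z) = ∫ z in Metric.ball (0 : ℂ) r, F z := by
  have hmp := (rotation ω).measurePreserving
  have := hmp.setIntegral_preimage_emb (rotation ω).toHomeomorph.measurableEmbedding F
    (Metric.ball (0 : ℂ) r)
  rw [← this]
  have hb : (rotation ω) ⁻¹' Metric.ball (0 : ℂ) r = Metric.ball (0 : ℂ) r := by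
    ext z
    simp only [Set.mem_preimage, mem_ball_zero_iff, LinearIsometryEquiv.norm_map]
  rw [hb]
  rfl

/-- Some rotation gives `z̄ᵐ zⁿ` the opposite sign. -/
theorem exists_circle_pow_eq_neg {m n : ℕ} (h : m ≠ n) :
    ∃ ω : Circle, (conj (ω : ℂ)) ^ m * (ω : ℂ) ^ n = -1 := by
  have hd : ((n : ℂ) - m) ≠ 0 := sub_ne_zero.2 (by exact_mod_cast h.symm)
  refine ⟨Circle.exp (Real.pi / ((n : ℝ) - m)), ?_⟩
  rw [← Circle.coe_inv_eq_conj, ← Circle.exp_neg, Circle.coe_exp, Circle.coe_exp,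
    ← Complex.exp_nat_mul, ← Complex.exp_nat_mul, ← Complex.exp_add, ← Complex.exp_pi_mul_I]
  congr 1
  push_cast
  field_simp
  ring

variable {η : ℝ}

theorem setIntegral_conj_pow_mul_pow_of_ne {m n : ℕ} (h : m ≠ n) (r : ℝ) (W : ℝ → ℂ) :
    ∫ z in Metric.ball (0 : ℂ) r, conj z ^ m * z ^ n * W ‖z‖ = 0 := by
  obtain ⟨ω, hω⟩ := exists_circle_pow_eq_neg h
  have := setIntegral_ball_rotate ω r fun z => conj z ^ m * z ^ n * W ‖z‖
  have h2 : ∀ z : ℂ, conj ((ω : ℂ) * z) ^ m * ((ω : ℂ) * z) ^ n * W ‖(ω : ℂ) * z‖ =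
      -(conj z ^ m * z ^ n * W ‖z‖) := fun z => by
    rw [norm_mul, Circle.norm_coe, one_mul, map_mul, mul_pow, mul_pow]
    linear_combination (conj z ^ m * z ^ n * W ‖z‖) * hω
  simp only [h2, integral_neg] at this
  linear_combination (-1 / 2 : ℂ) * this

theorem summable_norm_mul_pow {a : ℕ → ℂ} {f : ℂ → ℂ}
    (ha : ∀ z ∈ Metric.ball (0 : ℂ) 1, HasSum (fun k => a k * z ^ k) (f z)) {ρ : ℝ} (h0 : 0 ≤ ρ)
    (h1 : ρ < 1) : Summable fun k => ‖a k‖ * ρ ^ k := by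
  have := (ha ρ (by simpa [abs_of_nonneg h0] using h1)).summable.norm
  simpa [abs_of_nonneg h0] using this

theorem exists_hasSum (f : FB η) :
    ∃ a : ℕ → ℂ, ∀ z ∈ Metric.ball (0 : ℂ) 1, HasSum (fun k => a k * z ^ k) (f z) :=
  ⟨fun k => (k.factorial : ℂ)⁻¹ * iteratedDeriv k f.1 0, fun z hz => by
    have := Complex.hasSum_taylorSeries_on_ball f.2.1 hz
    simp only [sub_zero, smul_eq_mul] at this
    refine this.congr_fun fun k => ?_
    ring⟩

variable [hη : Fact (1 / 2 < η)]

/-- On a smaller disk a power series may be integrated term by term. -/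
theorem hasSum_setIntegral_mul_pow {g f : ℂ → ℂ} {a : ℕ → ℂ}
    (hg : ContinuousOn g (Metric.ball 0 1))
    (ha : ∀ z ∈ Metric.ball (0 : ℂ) 1, HasSum (fun k => a k * z ^ k) (f z)) {ρ : ℝ} (h0 : 0 ≤ ρ)
    (h1 : ρ < 1) :
    HasSum (fun k => a k * ∫ z in Metric.ball (0 : ℂ) ρ,
        g z * z ^ k * (((1 - ‖z‖ ^ 2) ^ (2 * η - 2) : ℝ) : ℂ))
      (∫ z in Metric.ball (0 : ℂ) ρ, g z * f z * (((1 - ‖z‖ ^ 2) ^ (2 * η - 2) : ℝ) : ℂ)) := by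
  have hsub : Metric.ball (0 : ℂ) ρ ⊆ Metric.ball 0 1 := Metric.ball_subset_ball h1.le
  obtain ⟨C, hC⟩ := (isCompact_closedBall (0 : ℂ) ρ).exists_bound_of_continuousOn
    (hg.mono (Metric.closedBall_subset_ball h1))
  have hC0 : 0 ≤ C := (norm_nonneg _).trans (hC 0 (by simpa using h0))
  have hW := (integrableOn_weight (η := η)).mono_set hsub
  have hb : ∀ k, ∀ z ∈ Metric.ball (0 : ℂ) ρ,
      ‖g z * (a k * z ^ k) * (((1 - ‖z‖ ^ 2) ^ (2 * η - 2) : ℝ) : ℂ)‖ ≤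
        C * (‖a k‖ * ρ ^ k) * (1 - ‖z‖ ^ 2) ^ (2 * η - 2) := fun k z hz => by
    have hz' : ‖z‖ < ρ := by simpa using hz
    rw [norm_mul, norm_mul, norm_mul, norm_pow, Complex.norm_real,
      Real.norm_of_nonneg (weight_nonneg (hsub hz) _)]
    have := weight_nonneg (hsub hz) (2 * η - 2)
    gcongr
    exact hC z (Metric.ball_subset_closedBall hz)
  have hmeas : ∀ k, AEStronglyMeasurable
      (fun z => g z * (a k * z ^ k) * (((1 - ‖z‖ ^ 2) ^ (2 * η - 2) : ℝ) : ℂ))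
      (volume.restrict (Metric.ball (0 : ℂ) ρ)) := fun k => by
    refine AEStronglyMeasurable.mul ?_
      (Complex.measurable_ofReal.comp (measurable_radial _)).aestronglyMeasurable
    exact ((hg.mono hsub).mul (by fun_prop)).aestronglyMeasurable measurableSet_ball
  have hint : ∀ k, IntegrableOn
      (fun z => g z * (a k * z ^ k) * (((1 - ‖z‖ ^ 2) ^ (2 * η - 2) : ℝ) : ℂ))
      (Metric.ball (0 : ℂ) ρ) := fun k => by
    refine (hW.const_mul (C * (‖a k‖ * ρ ^ k))).mono' (hmeas k) ?_
    filter_upwards [self_mem_ae_restrict measurableSet_ball] with z hz using hb k z hz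
  have hsum : Summable fun k => ∫ z in Metric.ball (0 : ℂ) ρ,
      ‖g z * (a k * z ^ k) * (((1 - ‖z‖ ^ 2) ^ (2 * η - 2) : ℝ) : ℂ)‖ := by
    refine Summable.of_nonneg_of_le (fun k => integral_nonneg fun _ => norm_nonneg _) (fun k => ?_)
      (((summable_norm_mul_pow ha h0 h1).mul_left C).mul_right
        (∫ z in Metric.ball (0 : ℂ) ρ, (1 - ‖z‖ ^ 2) ^ (2 * η - 2)))
    rw [← integral_const_mul]
    exact setIntegral_mono_on (hint k).norm (hW.const_mul _) measurableSet_ball (hb k)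
  have key := hasSum_integral_of_summable_integral_norm hint hsum
  have e1 : ∫ z in Metric.ball (0 : ℂ) ρ, ∑' k,
      g z * (a k * z ^ k) * (((1 - ‖z‖ ^ 2) ^ (2 * η - 2) : ℝ) : ℂ) =
      ∫ z in Metric.ball (0 : ℂ) ρ, g z * f z * (((1 - ‖z‖ ^ 2) ^ (2 * η - 2) : ℝ) : ℂ) := by
    refine setIntegral_congr_fun measurableSet_ball fun z hz => ?_
    have := (ha z (hsub hz)).tsum_eq
    simp only [tsum_mul_right, tsum_mul_left, this]
  rw [← e1]
  refine key.congr_fun fun k => ?_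
  rw [← integral_const_mul]
  congr 1
  funext z
  ring

/-- The moment `∫ |z|^(2k) (1 - |z|²)^(2η - 2)` over the disk of radius `ρ`. -/
def moment (η : ℝ) (k : ℕ) (ρ : ℝ) : ℝ :=
  ∫ z in Metric.ball (0 : ℂ) ρ, (‖z‖ ^ 2) ^ k * (1 - ‖z‖ ^ 2) ^ (2 * η - 2)

/-- Only the term of degree `m` survives the integration of a power series against `z̄ᵐ`. -/
theorem setIntegral_conj_pow_mul {f : ℂ → ℂ} {a : ℕ → ℂ}
    (ha : ∀ z ∈ Metric.ball (0 : ℂ) 1, HasSum (fun k => a k * z ^ k) (f z)) {ρ : ℝ} (h0 : 0 ≤ ρ)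
    (h1 : ρ < 1) (m : ℕ) :
    ∫ z in Metric.ball (0 : ℂ) ρ, conj z ^ m * f z * (((1 - ‖z‖ ^ 2) ^ (2 * η - 2) : ℝ) : ℂ) =
      a m * moment η m ρ := by
  have hs := hasSum_setIntegral_mul_pow (η := η) (g := fun z => conj z ^ m)
    ((Complex.continuous_conj.pow m).continuousOn) ha h0 h1
  rw [← hs.tsum_eq, tsum_eq_single m]
  · rw [moment, ← integral_complex_ofReal]
    congr 2
    funext z
    rw [← mul_pow, ← Complex.normSq_eq_conj_mul_self, Complex.normSq_eq_norm_sq]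
    push_cast
    rfl
  · intro k hk
    rw [setIntegral_conj_pow_mul_pow_of_ne hk.symm ρ
      (fun r => (((1 - r ^ 2) ^ (2 * η - 2) : ℝ) : ℂ)), mul_zero]

/-- An integral over the unit disk is the limit of the integrals over smaller disks. -/
theorem tendsto_setIntegral_ball {E : Type*} [NormedAddCommGroup E] [NormedSpace ℝ E]
    {F : ℂ → E} (hF : IntegrableOn F (Metric.ball 0 1)) :
    Tendsto (fun k : ℕ => ∫ z in Metric.ball (0 : ℂ) (1 - 1 / ((k : ℝ) + 1)), F z) atTop
      (𝓝 (∫ z in Metric.ball (0 : ℂ) 1, F z)) := by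
  have hU : (⋃ k : ℕ, Metric.ball (0 : ℂ) (1 - 1 / ((k : ℝ) + 1))) = Metric.ball 0 1 := by
    ext z
    simp only [Set.mem_iUnion, mem_ball_zero_iff]
    constructor
    · rintro ⟨k, hk⟩
      have : (0 : ℝ) < 1 / ((k : ℝ) + 1) := by positivity
      linarith
    · intro hz
      obtain ⟨k, hk⟩ := exists_nat_one_div_lt (sub_pos.2 hz)
      exact ⟨k, by linarith⟩
  have := tendsto_setIntegral_of_monotone (μ := volume) (f := F)
    (s := fun k : ℕ => Metric.ball (0 : ℂ) (1 - 1 / ((k : ℝ) + 1)))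
    (fun _ => measurableSet_ball) (fun i j hij => Metric.ball_subset_ball (by gcongr))
    (by rwa [hU])
  rwa [hU] at this

theorem one_sub_one_div_nonneg (k : ℕ) : 0 ≤ 1 - 1 / ((k : ℝ) + 1) := by
  rw [sub_nonneg, div_le_one (by positivity)]
  linarith [(Nat.cast_nonneg k : (0 : ℝ) ≤ k)]

theorem one_sub_one_div_lt_one (k : ℕ) : 1 - 1 / ((k : ℝ) + 1) < 1 := by
  have : (0 : ℝ) < 1 / ((k : ℝ) + 1) := by positivity
  linarith

theorem integrableOn_moment (k : ℕ) :
    IntegrableOn (fun z : ℂ => (‖z‖ ^ 2) ^ k * (1 - ‖z‖ ^ 2) ^ (2 * η - 2))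
      (Metric.ball (0 : ℂ) 1) := by
  refine (integrableOn_weight (η := η)).mono' (by fun_prop) ?_
  filter_upwards [self_mem_ae_restrict measurableSet_ball] with z hz
  have hw := weight_nonneg hz (2 * η - 2)
  have hz' : ‖z‖ < 1 := by simpa using hz
  rw [norm_mul, Real.norm_of_nonneg hw, norm_pow, norm_pow, norm_norm]
  exact mul_le_of_le_one_left hw
    (pow_le_one₀ (by positivity) (pow_le_one₀ (norm_nonneg _) hz'.le))

/-- The coefficient `(s)_k / k!` of `x^k` in `(1 - x)^(-s)`. -/
def binomCoeff (s : ℝ) (k : ℕ) : ℝ := (ascPochhammer ℝ k).eval s / k.factorial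

/-- The squared normalization constant `(2η)_n / n!` of `e_n`. -/
def normSqConst (η : ℝ) (n : ℕ) : ℝ := binomCoeff (2 * η) n

theorem two_eta_pos : 0 < 2 * η := by linarith [hη.out]

theorem normSqConst_pos (n : ℕ) : 0 < normSqConst η n :=
  div_pos (ascPochhammer_pos n _ two_eta_pos) (by positivity)

/-- The Beta integral that normalizes the basis: `‖zᵏ‖² = k! / (2η)_k`. -/
theorem moment_one (k : ℕ) :
    (2 * η - 1) / Real.pi * moment η k 1 = (normSqConst η k)⁻¹ := by
  have h := hη.out
  rw [moment, integral_ball_comp_norm_sq (fun u => u ^ k * (1 - u) ^ (2 * η - 2)),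
    show 2 * η - 2 = (2 * η - 1) - 1 by ring, integral_pow_mul_one_sub_rpow (by linarith) k,
    normSqConst, binomCoeff, inv_div, ascPochhammer_succ_left]
  have h1 := Real.pi_pos.ne'
  have h2 : 2 * η - 1 ≠ 0 := by linarith
  have h3 := (ascPochhammer_pos k (2 * η) two_eta_pos).ne'
  simp only [Polynomial.eval_mul, Polynomial.eval_X, Polynomial.eval_comp, Polynomial.eval_add,
    Polynomial.eval_one, sub_add_cancel]
  field_simp

theorem moment_le {ρ : ℝ} (hρ : ρ ≤ 1) (k : ℕ) : moment η k ρ ≤ moment η k 1 :=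
  setIntegral_mono_set (integrableOn_moment k)
    (by
      filter_upwards [self_mem_ae_restrict measurableSet_ball] with z hz
      exact mul_nonneg (by positivity) (weight_nonneg hz _))
    (Metric.ball_subset_ball hρ).eventuallyLE

theorem e_apply (n : ℕ) {z : ℂ} (hz : z ∈ Metric.ball (0 : ℂ) 1) :
    e η n z = ((Real.sqrt (normSqConst η n) : ℝ) : ℂ) * z ^ n := by
  have h : e η n z = ((Real.sqrt (Real.Gamma (2 * η + n) / Real.Gamma (2 * η) / n.factorial) : ℝ) :
      ℂ) * z ^ n := by
    simp only [e, Set.indicator_of_mem hz]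
  rw [h, Gamma_add_nat_div_Gamma two_eta_pos, normSqConst, binomCoeff]

theorem inner_eq_fbInner (f g : FB η) : inner ℂ f g = fbInner f g := rfl

/-- The coefficients of `f` in the basis `e_n` are its normalized Taylor coefficients. -/
theorem inner_e_eq {f : FB η} {a : ℕ → ℂ}
    (ha : ∀ z ∈ Metric.ball (0 : ℂ) 1, HasSum (fun k => a k * z ^ k) (f z)) (n : ℕ) :
    inner ℂ (e η n) f = a n / ((Real.sqrt (normSqConst η n) : ℝ) : ℂ) := by
  set N : ℝ := Real.sqrt (normSqConst η n) with hN
  have hN2 : N * N = normSqConst η n := Real.mul_self_sqrt (normSqConst_pos n).le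
  have hN0 : N ≠ 0 := (Real.sqrt_pos.2 (normSqConst_pos n)).ne'
  have hi := integrableOn_inner (e η n) f
  have he : ∀ {ρ : ℝ}, ρ ≤ 1 → ∫ z in Metric.ball (0 : ℂ) ρ,
      conj (e η n z) * f z * (((1 - ‖z‖ ^ 2) ^ (2 * η - 2) : ℝ) : ℂ) =
      N * ∫ z in Metric.ball (0 : ℂ) ρ,
        conj z ^ n * f z * (((1 - ‖z‖ ^ 2) ^ (2 * η - 2) : ℝ) : ℂ) := fun hρ => by
    rw [← integral_const_mul]
    refine setIntegral_congr_fun measurableSet_ball fun z hz => ?_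
    rw [e_apply n (Metric.ball_subset_ball hρ hz), map_mul, Complex.conj_ofReal, map_pow]
    ring
  have h1 := tendsto_setIntegral_ball hi
  have h2 : Tendsto (fun k : ℕ => (N : ℂ) * (a n * moment η n (1 - 1 / ((k : ℝ) + 1)))) atTop
      (𝓝 (N * (a n * moment η n 1))) := by
    refine Tendsto.const_mul _ (Tendsto.const_mul _ ?_)
    exact (Complex.continuous_ofReal.tendsto _).comp
      (tendsto_setIntegral_ball (integrableOn_moment (η := η) n))
  have h3 := tendsto_nhds_unique (h1.congr fun k => by
    rw [he (one_sub_one_div_lt_one k).le, setIntegral_conj_pow_mul ha (one_sub_one_div_nonneg k)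
      (one_sub_one_div_lt_one k)]) h2
  rw [inner_eq_fbInner, fbInner, h3]
  have h4 := moment_one (η := η) n
  have h5 : (((2 * η - 1) / Real.pi : ℝ) : ℂ) * moment η n 1 = ((N * N : ℝ) : ℂ)⁻¹ := by
    rw [hN2]; exact_mod_cast congrArg ((↑) : ℝ → ℂ) h4
  calc _ = N * a n * ((((2 * η - 1) / Real.pi : ℝ) : ℂ) * moment η n 1) := by ring
    _ = _ := by
      rw [h5]
      push_cast
      have : (N : ℂ) ≠ 0 := by exact_mod_cast hN0
      field_simp

/-- The Taylor expansion of `f`, in terms of its coefficients in the basis `e_n`. -/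
theorem hasSum_e (f : FB η) : ∀ z ∈ Metric.ball (0 : ℂ) 1,
    HasSum (fun k => inner ℂ (e η k) f * ((Real.sqrt (normSqConst η k) : ℝ) : ℂ) * z ^ k)
      (f z) := by
  obtain ⟨a, ha⟩ := exists_hasSum f
  intro z hz
  refine (ha z hz).congr_fun fun k => ?_
  have : ((Real.sqrt (normSqConst η k) : ℝ) : ℂ) ≠ 0 := by
    exact_mod_cast (Real.sqrt_pos.2 (normSqConst_pos k)).ne'
  rw [inner_e_eq ha, div_mul_cancel₀ _ this]

theorem FB.ext_inner {f g : FB η} (h : ∀ n, inner ℂ (e η n) f = inner ℂ (e η n) g) : f = g :=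
  FB.ext fun z hz => (hasSum_e f z hz).unique (by simpa only [h] using hasSum_e g z hz)

theorem orthonormal_e : Orthonormal ℂ (e η) := by
  rw [orthonormal_iff_ite]
  intro m n
  have ha : ∀ z ∈ Metric.ball (0 : ℂ) 1, HasSum (fun k =>
      (if k = n then ((Real.sqrt (normSqConst η n) : ℝ) : ℂ) else 0) * z ^ k) (e η n z) := by
    intro z hz
    rw [e_apply n hz]
    convert hasSum_ite_eq n (((Real.sqrt (normSqConst η n) : ℝ) : ℂ) * z ^ n) using 2 with k
    split_ifs with h <;> simp [h]
  rw [inner_e_eq ha]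
  split_ifs with h
  · subst h
    exact div_self (by exact_mod_cast (Real.sqrt_pos.2 (normSqConst_pos m)).ne')
  · simp

theorem norm_sq_eq_integral (f : FB η) : ‖f‖ ^ 2 = (2 * η - 1) / Real.pi *
    ∫ z in Metric.ball (0 : ℂ) 1, ‖f z‖ ^ 2 * (1 - ‖z‖ ^ 2) ^ (2 * η - 2) := by
  have h : RCLike.re (inner ℂ f f) = ‖f‖ ^ 2 := inner_self_eq_norm_sq (𝕜 := ℂ) f
  rw [← h, inner_eq_fbInner, fbInner_self, RCLike.re_to_complex, Complex.ofReal_re]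

/-- Parseval's identity. Expanding only one factor of `|f|²` in its Taylor series reduces the
integral over the disk of radius `ρ < 1` to integrals against monomials; `ρ → 1` gives the
inequality that complements Bessel's. -/
theorem hasSum_norm_sq (f : FB η) : HasSum (fun n => ‖inner ℂ (e η n) f‖ ^ 2) (‖f‖ ^ 2) := by
  have hs : Summable fun n => ‖inner ℂ (e η n) f‖ ^ 2 := orthonormal_e.inner_products_summable f
  refine (hs.hasSum_iff).2 (le_antisymm (orthonormal_e.tsum_inner_products_le f) ?_)
  obtain ⟨a, ha⟩ := exists_hasSum f
  have hc : ∀ n, ‖inner ℂ (e η n) f‖ ^ 2 =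
      (2 * η - 1) / Real.pi * (‖a n‖ ^ 2 * moment η n 1) := fun n => by
    rw [mul_left_comm, moment_one, inner_e_eq ha, norm_div, Complex.norm_real, div_pow,
      Real.norm_of_nonneg (Real.sqrt_nonneg _), Real.sq_sqrt (normSqConst_pos n).le]
    rfl
  have hc0 : 0 < (2 * η - 1) / Real.pi := fbConst_pos
  have hs' : Summable fun n => ‖a n‖ ^ 2 * moment η n 1 := by
    have := hs
    simp only [hc] at this
    exact (summable_mul_left_iff hc0.ne').1 this
  simp only [hc, tsum_mul_left]
  rw [norm_sq_eq_integral]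
  refine mul_le_mul_of_nonneg_left ?_ hc0.le
  refine le_of_tendsto (tendsto_setIntegral_ball f.2.2.2) (Eventually.of_forall fun k => ?_)
  set ρ : ℝ := 1 - 1 / ((k : ℝ) + 1)
  have h0 : 0 ≤ ρ := one_sub_one_div_nonneg k
  have h1 : ρ < 1 := one_sub_one_div_lt_one k
  have hsum := hasSum_setIntegral_mul_pow (η := η) (g := fun z => conj (f z))
    (Complex.continuous_conj.comp_continuousOn f.2.1.continuousOn) ha h0 h1
  have e1 : ∀ n, a n * ∫ z in Metric.ball (0 : ℂ) ρ,
      conj (f z) * z ^ n * (((1 - ‖z‖ ^ 2) ^ (2 * η - 2) : ℝ) : ℂ) =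
      ((‖a n‖ ^ 2 * moment η n ρ : ℝ) : ℂ) := fun n => by
    have := congrArg conj (setIntegral_conj_pow_mul (η := η) ha h0 h1 n)
    rw [← integral_conj] at this
    have h2 : ∀ z : ℂ, conj (conj z ^ n * f z * (((1 - ‖z‖ ^ 2) ^ (2 * η - 2) : ℝ) : ℂ)) =
        conj (f z) * z ^ n * (((1 - ‖z‖ ^ 2) ^ (2 * η - 2) : ℝ) : ℂ) := fun z => by
      simp only [map_mul, map_pow, Complex.conj_conj, Complex.conj_ofReal]
      ring
    simp only [h2] at this
    rw [this, map_mul, Complex.conj_ofReal, ← mul_assoc, Complex.mul_conj,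
      Complex.normSq_eq_norm_sq]
    push_cast
    rfl
  have e2 : ∫ z in Metric.ball (0 : ℂ) ρ,
      conj (f z) * f z * (((1 - ‖z‖ ^ 2) ^ (2 * η - 2) : ℝ) : ℂ) =
      ((∫ z in Metric.ball (0 : ℂ) ρ, ‖f z‖ ^ 2 * (1 - ‖z‖ ^ 2) ^ (2 * η - 2) : ℝ) : ℂ) := by
    rw [← integral_complex_ofReal]
    congr 1
    funext z
    rw [← Complex.normSq_eq_conj_mul_self, Complex.normSq_eq_norm_sq]
    push_cast
    rfl
  simp only [e1, e2] at hsum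
  have hsum' := Complex.hasSum_ofReal.1 hsum
  rw [← hsum'.tsum_eq]
  exact hsum'.summable.tsum_le_tsum
    (fun n => mul_le_mul_of_nonneg_left (moment_le h1.le n) (by positivity)) hs'

/-- Every `f` is the sum of its expansion in the basis `e_n`. Parseval's identity gives this without
the completeness of the space. -/
theorem hasSum_inner_smul_e (f : FB η) : HasSum (fun n => inner ℂ (e η n) f • e η n) f := by
  have h1 : ∀ s : Finset ℕ, ‖(∑ n ∈ s, inner ℂ (e η n) f • e η n) - f‖ ^ 2 =
      ‖f‖ ^ 2 - ∑ n ∈ s, ‖inner ℂ (e η n) f‖ ^ 2 := fun s => by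
    have a1 : inner ℂ (∑ n ∈ s, inner ℂ (e η n) f • e η n) f =
        ((∑ n ∈ s, ‖inner ℂ (e η n) f‖ ^ 2 : ℝ) : ℂ) := by
      rw [sum_inner]
      push_cast
      refine Finset.sum_congr rfl fun n _ => ?_
      rw [inner_smul_left, Complex.conj_mul']
    have a2 : inner ℂ (∑ n ∈ s, inner ℂ (e η n) f • e η n)
        (∑ n ∈ s, inner ℂ (e η n) f • e η n) =
        ((∑ n ∈ s, ‖inner ℂ (e η n) f‖ ^ 2 : ℝ) : ℂ) := by
      rw [orthonormal_e.inner_sum]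
      push_cast
      exact Finset.sum_congr rfl fun n _ => Complex.conj_mul' _
    rw [@norm_sub_sq ℂ, a1, ← inner_self_eq_norm_sq (𝕜 := ℂ), a2]
    simp only [RCLike.re_to_complex, Complex.ofReal_re]
    ring
  have h2 : Tendsto (fun s : Finset ℕ => ‖(∑ n ∈ s, inner ℂ (e η n) f • e η n) - f‖ ^ 2) atTop
      (𝓝 0) := by
    simp only [h1]
    have := (tendsto_const_nhds (x := ‖f‖ ^ 2)).sub (hasSum_norm_sq f)
    simpa using this
  refine tendsto_iff_norm_sub_tendsto_zero.2 ?_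
  have := h2.sqrt
  simpa using this

theorem hasSum_inner_mul_inner_e (f g : FB η) :
    HasSum (fun n => inner ℂ f (e η n) * inner ℂ (e η n) g) (inner ℂ f g) := by
  have h := (hasSum_inner_smul_e g).mapL (innerSL ℂ f)
  simpa [inner_smul_right, mul_comm] using h

end

section

variable {η : ℝ} [hη : Fact (1 / 2 < η)]

/-! ### Traces -/

/-- The Cauchy-Schwarz inequality for coefficient sequences. -/
theorem sum_norm_inner_mul_norm_inner_le (x y : FB η) (s : Finset ℕ) :
    ∑ n ∈ s, ‖inner ℂ x (e η n) * inner ℂ (e η n) y‖ ≤ ‖x‖ * ‖y‖ := by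
  have h0 : 0 ≤ ∑ n ∈ s, ‖inner ℂ x (e η n) * inner ℂ (e η n) y‖ :=
    Finset.sum_nonneg fun _ _ => norm_nonneg _
  refine (sq_le_sq₀ h0 (by positivity)).1 ?_
  have h1 := Finset.sum_mul_sq_le_sq_mul_sq s (fun n => ‖inner ℂ x (e η n)‖)
    (fun n => ‖inner ℂ (e η n) y‖)
  simp only [norm_mul]
  refine h1.trans ?_
  rw [mul_pow]
  have hx : ∑ n ∈ s, ‖inner ℂ x (e η n)‖ ^ 2 ≤ ‖x‖ ^ 2 := by
    simp only [fun n => norm_inner_symm (𝕜 := ℂ) x (e η n)]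
    exact sum_le_hasSum s (fun _ _ => by positivity) (hasSum_norm_sq x)
  have hy : ∑ n ∈ s, ‖inner ℂ (e η n) y‖ ^ 2 ≤ ‖y‖ ^ 2 :=
    sum_le_hasSum s (fun _ _ => by positivity) (hasSum_norm_sq y)
  gcongr

theorem summable_norm_inner_mul_inner (x y : FB η) :
    Summable fun n => ‖inner ℂ x (e η n) * inner ℂ (e η n) y‖ :=
  summable_of_sum_le (fun _ => norm_nonneg _) (sum_norm_inner_mul_norm_inner_le x y)

/-- The trace of `∑ₖ |y_k⟩⟨x_k|` is `∑ₖ ⟨x_k | y_k⟩`. -/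
theorem trace_eq_tsum_inner {T : FB η →L[ℂ] FB η} {x y : ℕ → FB η}
    (hs : Summable fun k => ‖x k‖ * ‖y k‖)
    (hT : ∀ v, HasSum (fun k => inner ℂ (x k) v • y k) (T v)) :
    trace T = ∑' k, inner ℂ (x k) (y k) := by
  have h1 : ∀ n, inner ℂ (e η n) (T (e η n)) =
      ∑' k, inner ℂ (x k) (e η n) * inner ℂ (e η n) (y k) := fun n => by
    have := (hT (e η n)).mapL (innerSL ℂ (e η n))
    simpa [inner_smul_right] using this.tsum_eq.symm
  have h2 : ∀ k, inner ℂ (x k) (y k) =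
      ∑' n, inner ℂ (x k) (e η n) * inner ℂ (e η n) (y k) := fun k =>
    (hasSum_inner_mul_inner_e (x k) (y k)).tsum_eq.symm
  simp only [trace, h1, h2]
  refine Summable.tsum_comm (f := fun k n => inner ℂ (x k) (e η n) * inner ℂ (e η n) (y k)) ?_
  refine Summable.of_norm ((summable_prod_of_nonneg fun _ => norm_nonneg _).2
    ⟨fun k => summable_norm_inner_mul_inner (x k) (y k), ?_⟩)
  refine Summable.of_nonneg_of_le (fun k => tsum_nonneg fun _ => norm_nonneg _) (fun k => ?_) hs
  exact (summable_norm_inner_mul_inner (x k) (y k)).tsum_le_of_sum_le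
    (sum_norm_inner_mul_norm_inner_le (x k) (y k))

theorem IsTraceClass.comp_left {T : FB η →L[ℂ] FB η} (hT : IsTraceClass T)
    (A : FB η →L[ℂ] FB η) : IsTraceClass (A ∘L T) := by
  obtain ⟨x, y, hs, h⟩ := hT
  refine ⟨x, fun k => A (y k), ?_, fun v => ?_⟩
  · refine Summable.of_nonneg_of_le (fun k => by positivity) (fun k => ?_) (hs.mul_left ‖A‖)
    calc ‖x k‖ * ‖A (y k)‖ ≤ ‖x k‖ * (‖A‖ * ‖y k‖) := by gcongr; exact A.le_opNorm _
      _ = ‖A‖ * (‖x k‖ * ‖y k‖) := by ring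
  · simpa using (h v).mapL A

/-- The trace of a trace-class operator is invariant under unitary conjugation. -/
theorem IsTraceClass.trace_conj {T T' : FB η →L[ℂ] FB η} (hT : IsTraceClass T)
    (V : FB η ≃ₗᵢ[ℂ] FB η) (hT' : ∀ v, T' (V v) = V (T v)) : trace T' = trace T := by
  obtain ⟨x, y, hs, h⟩ := hT
  rw [trace_eq_tsum_inner hs h,
    trace_eq_tsum_inner (x := fun k => V (x k)) (y := fun k => V (y k)) (by simpa using hs)]
  · simp
  · intro v
    obtain ⟨v, rfl⟩ := V.surjective v
    rw [hT' v]
    simpa using (h v).mapL (V : FB η →L[ℂ] FB η)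

/-! ### The invariant measure -/

theorem norm_coe_lt_one (z : Disk) : ‖(z : ℂ)‖ < 1 := mem_ball_zero_iff.1 z.2

theorem one_sub_norm_sq_pos (z : Disk) : 0 < 1 - ‖(z : ℂ)‖ ^ 2 := by
  nlinarith [norm_coe_lt_one z, norm_nonneg (z : ℂ)]

theorem measurable_density :
    Measurable fun z : Disk => ENNReal.ofReal (((1 - ‖(z : ℂ)‖ ^ 2) ^ 2)⁻¹) := by fun_prop

theorem hypMeasure_apply {s : Set Disk} (hs : MeasurableSet s) :
    hypMeasure s = ∫⁻ z in ((↑) : Disk → ℂ) '' s, ENNReal.ofReal (((1 - ‖z‖ ^ 2) ^ 2)⁻¹) := by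
  rw [hypMeasure, withDensity_apply _ hs, ← setLIntegral_subtype measurableSet_ball]

/-- A holomorphic bijection of the disk that satisfies the equality case of the Schwarz-Pick lemma
preserves the invariant measure. -/
theorem measurePreserving_of_hasDerivAt (g : Disk ≃ᵐ Disk) (G G' : ℂ → ℂ)
    (hG : ∀ z : Disk, (g z : ℂ) = G z)
    (hd : ∀ z ∈ Metric.ball (0 : ℂ) 1, HasDerivAt G (G' z) z)
    (hn : ∀ z ∈ Metric.ball (0 : ℂ) 1, ‖G' z‖ * (1 - ‖z‖ ^ 2) = 1 - ‖G z‖ ^ 2) :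
    MeasurePreserving g hypMeasure hypMeasure := by
  refine ⟨g.measurable, Measure.ext fun s hs => ?_⟩
  rw [g.map_apply, hypMeasure_apply (g.measurable hs), hypMeasure_apply hs]
  set t : Set ℂ := ((↑) : Disk → ℂ) '' (g ⁻¹' s) with ht
  have htb : t ⊆ Metric.ball 0 1 := Subtype.coe_image_subset _ _
  have htm : MeasurableSet t :=
    (MeasurableEmbedding.subtype_coe measurableSet_ball).measurableSet_image.2 (g.measurable hs)
  have himg : ((↑) : Disk → ℂ) '' s = G '' t := by
    ext w
    constructor
    · rintro ⟨z, hz, rfl⟩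
      exact ⟨_, ⟨g.symm z, by simpa using hz, rfl⟩, by rw [← hG, g.apply_symm_apply]⟩
    · rintro ⟨_, ⟨z, hz, rfl⟩, rfl⟩
      exact ⟨g z, hz, hG z⟩
  have hinj : Set.InjOn G t := by
    rintro _ ⟨z, _, rfl⟩ _ ⟨w, _, rfl⟩ h
    rw [← hG, ← hG] at h
    rw [g.injective (Subtype.ext h)]
  rw [himg, lintegral_image_eq_lintegral_abs_det_fderiv_mul volume htm
    (f' := fun z => (ContinuousLinearMap.toSpanSingleton ℂ (G' z)).restrictScalars ℝ)
    (fun z hz => ((hd z (htb hz)).hasFDerivAt.restrictScalars ℝ).hasFDerivWithinAt) hinj]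
  refine setLIntegral_congr_fun htm fun z hz => ?_
  have hz1 : ‖z‖ < 1 := by simpa using htb hz
  have hp : 0 < 1 - ‖z‖ ^ 2 := by nlinarith [norm_nonneg z]
  have hGz : 0 < 1 - ‖G z‖ ^ 2 := by
    have := one_sub_norm_sq_pos (g ⟨z, htb hz⟩)
    rwa [hG] at this
  have hdet : ((ContinuousLinearMap.toSpanSingleton ℂ (G' z)).restrictScalars ℝ).det =
      ‖G' z‖ ^ 2 := by
    simp only [ContinuousLinearMap.det, ContinuousLinearMap.coe_restrictScalars,
      LinearMap.det_restrictScalars, Algebra.norm_complex_eq]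
    simp [Complex.normSq_eq_norm_sq]
  simp only [hdet, abs_of_nonneg (sq_nonneg ‖G' z‖)]
  rw [← ENNReal.ofReal_mul (sq_nonneg _), ← hn z (htb hz)]
  congr 1
  have : ‖G' z‖ ≠ 0 := fun h => by
    have := hn z (htb hz)
    rw [h, zero_mul] at this
    exact hGz.ne this
  field_simp

/-- The transformation `z ↦ (z - a) / (1 - z ā)` of the disk. -/
def diskMoebius (a : Disk) : Disk ≃ᵐ Disk where
  toFun z := ⟨moebius a z, mem_ball_zero_iff.2 (norm_moebius_lt (norm_coe_lt_one a)
    (norm_coe_lt_one z))⟩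
  invFun z := ⟨moebius (-a) z, mem_ball_zero_iff.2 (norm_moebius_lt
    (by rw [norm_neg]; exact norm_coe_lt_one a) (norm_coe_lt_one z))⟩
  left_inv z := Subtype.ext (moebius_neg_moebius (norm_coe_lt_one a) (norm_coe_lt_one z))
  right_inv z := Subtype.ext (by
    have := moebius_neg_moebius (a := -(a : ℂ)) (by rw [norm_neg]; exact norm_coe_lt_one a)
      (norm_coe_lt_one z)
    rwa [neg_neg] at this)
  measurable_toFun := by
    refine Measurable.subtype_mk ?_
    unfold moebius
    fun_prop
  measurable_invFun := by
    refine Measurable.subtype_mk ?_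
    unfold moebius
    fun_prop

theorem coe_diskMoebius (a z : Disk) : (diskMoebius a z : ℂ) = moebius a z := rfl

theorem measurePreserving_diskMoebius (a : Disk) :
    MeasurePreserving (diskMoebius a) hypMeasure hypMeasure := by
  have ha := norm_coe_lt_one a
  refine measurePreserving_of_hasDerivAt _ (moebius a)
    (fun z => (((1 - ‖(a : ℂ)‖ ^ 2 : ℝ)) : ℂ) / (1 - z * conj (a : ℂ)) ^ 2)
    (fun z => rfl) (fun z hz => hasDerivAt_moebius ha (by simpa using hz)) fun z hz => ?_
  rw [one_sub_normSq_moebius ha (by simpa using hz), norm_div, norm_pow, Complex.norm_real,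
    Real.norm_of_nonneg (one_sub_norm_sq_pos a).le]
  ring

/-- The rotation `z ↦ ω z` of the disk. -/
def diskRotation (ω : Circle) : Disk ≃ᵐ Disk where
  toFun z := ⟨ω * z, mem_ball_zero_iff.2 (by
    rw [norm_mul, Circle.norm_coe, one_mul]; exact norm_coe_lt_one z)⟩
  invFun z := ⟨(ω⁻¹ : Circle) * z, mem_ball_zero_iff.2 (by
    rw [norm_mul, Circle.norm_coe, one_mul]; exact norm_coe_lt_one z)⟩
  left_inv z := Subtype.ext (by simp)
  right_inv z := Subtype.ext (by simp)
  measurable_toFun := by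
    refine Measurable.subtype_mk ?_
    fun_prop
  measurable_invFun := by
    refine Measurable.subtype_mk ?_
    fun_prop

theorem coe_diskRotation (ω : Circle) (z : Disk) : (diskRotation ω z : ℂ) = ω * z := rfl

theorem norm_diskRotation (ω : Circle) (z : Disk) : ‖(diskRotation ω z : ℂ)‖ = ‖(z : ℂ)‖ := by
  rw [coe_diskRotation, norm_mul, Circle.norm_coe, one_mul]

theorem measurePreserving_diskRotation (ω : Circle) :
    MeasurePreserving (diskRotation ω) hypMeasure hypMeasure :=
  measurePreserving_of_hasDerivAt _ (fun z => ω * z) (fun _ => ω) (fun z => rfl)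
    (fun z _ => by simpa using (hasDerivAt_id z).const_mul (ω : ℂ)) fun z _ => by
      simp only [norm_mul, Circle.norm_coe, one_mul]

theorem integral_hypMeasure {E : Type*} [NormedAddCommGroup E] [NormedSpace ℝ E] (F : ℂ → E) :
    ∫ z : Disk, F z ∂hypMeasure =
      ∫ z in Metric.ball (0 : ℂ) 1, (((1 - ‖z‖ ^ 2) ^ 2)⁻¹ : ℝ) • F z := by
  rw [hypMeasure, integral_withDensity_eq_integral_toReal_smul
    measurable_density (Eventually.of_forall fun _ =>
      ENNReal.ofReal_lt_top), ← integral_subtype_comap measurableSet_ball]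
  congr 1
  funext z
  rw [ENNReal.toReal_ofReal (by positivity)]

theorem integrable_hypMeasure_iff {E : Type*} [NormedAddCommGroup E] [NormedSpace ℝ E]
    (F : ℂ → E) : Integrable (fun z : Disk => F z) hypMeasure ↔
      IntegrableOn (fun z => (((1 - ‖z‖ ^ 2) ^ 2)⁻¹ : ℝ) • F z) (Metric.ball (0 : ℂ) 1) := by
  rw [hypMeasure, integrable_withDensity_iff_integrable_smul'
    measurable_density (Eventually.of_forall fun _ =>
      ENNReal.ofReal_lt_top), IntegrableOn, ← map_comap_subtype_coe measurableSet_ball,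
    (MeasurableEmbedding.subtype_coe measurableSet_ball).integrable_map_iff]
  refine iff_of_eq (congrArg (fun f => Integrable f _) ?_)
  funext z
  rw [ENNReal.toReal_ofReal (by positivity)]
  rfl

theorem inv_sq_mul_rpow {x : ℝ} (hx : 0 < x) (s : ℝ) : (x ^ 2)⁻¹ * x ^ s = x ^ (s - 2) := by
  rw [Real.rpow_sub hx, Real.rpow_two]
  ring

theorem integrable_one_sub_norm_sq_rpow {s : ℝ} (hs : 1 < s) :
    Integrable (fun z : Disk => (1 - ‖(z : ℂ)‖ ^ 2) ^ s) hypMeasure := by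
  refine (integrable_hypMeasure_iff fun z => (1 - ‖z‖ ^ 2) ^ s).2 ?_
  refine (integrableOn_one_sub_norm_sq_rpow (s := s - 2) (by linarith)).congr_fun (fun z hz => ?_)
    measurableSet_ball
  exact (inv_sq_mul_rpow (one_sub_norm_sq_pos ⟨z, hz⟩) s).symm

theorem integral_norm_sq_pow_mul_rpow {s : ℝ} (hs : 1 < s) (k : ℕ) :
    ∫ z : Disk, (‖(z : ℂ)‖ ^ 2) ^ k * (1 - ‖(z : ℂ)‖ ^ 2) ^ s ∂hypMeasure =
      Real.pi * (k.factorial / (ascPochhammer ℝ (k + 1)).eval (s - 1)) := by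
  rw [integral_hypMeasure fun z => (‖z‖ ^ 2) ^ k * (1 - ‖z‖ ^ 2) ^ s,
    ← integral_pow_mul_one_sub_rpow (by linarith : 0 < s - 1),
    ← integral_ball_comp_norm_sq fun u => u ^ k * (1 - u) ^ (s - 1 - 1)]
  refine setIntegral_congr_fun measurableSet_ball fun z hz => ?_
  simp only [smul_eq_mul]
  rw [mul_left_comm, inv_sq_mul_rpow (one_sub_norm_sq_pos ⟨z, hz⟩), sub_sub]
  norm_num

end

section

variable {η : ℝ}

/-! ### Rotations and the composition law of the representation -/

theorem smul_mem_ball (ω : Circle) {z : ℂ} :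
    (ω : ℂ) * z ∈ Metric.ball (0 : ℂ) 1 ↔ z ∈ Metric.ball (0 : ℂ) 1 := by
  simp only [mem_ball_zero_iff, norm_mul, Circle.norm_coe, one_mul]

/-- The rotation operator `(R_ω f)(z) = f (ω z)`. -/
def rot (ω : Circle) (f : FB η) : FB η :=
  ⟨fun z => f (ω * z), by
    refine ⟨f.2.1.comp (by fun_prop) fun z hz => (smul_mem_ball ω).2 hz,
      fun z hz => f.2.2.1 _ fun h => hz ((smul_mem_ball ω).1 h), ?_⟩
    have h := f.2.2.2
    rw [← integrable_indicator_iff measurableSet_ball] at h ⊢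
    have h2 := ((rotation ω).measurePreserving.integrable_comp_emb
      (rotation ω).toHomeomorph.measurableEmbedding).2 h
    refine h2.congr (Eventually.of_forall fun z => ?_)
    by_cases hz : z ∈ Metric.ball (0 : ℂ) 1
    · simp only [Function.comp, rotation_apply, norm_mul, Circle.norm_coe, one_mul,
        Set.indicator_of_mem hz, Set.indicator_of_mem ((smul_mem_ball ω).2 hz)]
    · rw [Function.comp, rotation_apply, Set.indicator_of_notMem hz,
        Set.indicator_of_notMem (mt (smul_mem_ball ω).1 hz)]⟩

theorem rot_apply (ω : Circle) (f : FB η) (z : ℂ) : rot ω f z = f (ω * z) := rfl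

theorem rot_rot_inv (ω : Circle) (f : FB η) : rot ω (rot ω⁻¹ f) = f := by
  refine FB.ext fun z _ => ?_
  rw [rot_apply, rot_apply]
  simp

variable [hη : Fact (1 / 2 < η)]

theorem inner_e_rot (ω : Circle) (f : FB η) (n : ℕ) :
    inner ℂ (e η n) (rot ω f) = (ω : ℂ) ^ n * inner ℂ (e η n) f := by
  have h : ∀ z ∈ Metric.ball (0 : ℂ) 1, HasSum (fun k => (inner ℂ (e η k) f *
      ((Real.sqrt (normSqConst η k) : ℝ) : ℂ) * (ω : ℂ) ^ k) * z ^ k) (rot ω f z) := by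
    intro z hz
    refine (hasSum_e f _ ((smul_mem_ball ω).2 hz)).congr_fun fun k => ?_
    rw [mul_pow]
    ring
  have hN : ((Real.sqrt (normSqConst η n) : ℝ) : ℂ) ≠ 0 := by
    exact_mod_cast (Real.sqrt_pos.2 (normSqConst_pos n)).ne'
  rw [inner_e_eq h]
  field_simp

theorem rot_e (ω : Circle) (n : ℕ) : rot ω (e η n) = (ω : ℂ) ^ n • e η n := by
  refine FB.ext_inner fun m => ?_
  rw [inner_e_rot, inner_smul_right, orthonormal_iff_ite.1 orthonormal_e]
  split_ifs with h
  · rw [h]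
  · simp

theorem U_apply (a : Disk) (f : FB η) {z : ℂ} (hz : z ∈ Metric.ball (0 : ℂ) 1) :
    U η a f z = (((1 - ‖(a : ℂ)‖ ^ 2) ^ η : ℝ) : ℂ) *
      (1 - z * conj (a : ℂ)) ^ (((-2 * η : ℝ)) : ℂ) * f (moebius a z) := by
  have : U η a f z = repFun η a f z := rfl
  rw [this, repFun, Set.indicator_of_mem hz]

theorem U_symm_apply (a : Disk) (f : FB η) {z : ℂ} (hz : z ∈ Metric.ball (0 : ℂ) 1) :
    (U η a).symm f z = (((1 - ‖(a : ℂ)‖ ^ 2) ^ η : ℝ) : ℂ) *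
      (1 - z * conj (-a : ℂ)) ^ (((-2 * η : ℝ)) : ℂ) * f (moebius (-a) z) := by
  have : (U η a).symm f z = repFun η (-a) f z := rfl
  rw [this, repFun, Set.indicator_of_mem hz, norm_neg]

/-- Rotations intertwine the operators `U(p(a))`, without a phase. -/
theorem U_diskRotation (ω : Circle) (a : Disk) (f : FB η) :
    U η (diskRotation ω a) f = rot ω⁻¹ (U η a (rot ω f)) := by
  refine FB.ext fun z hz => ?_
  have hω : (ω : ℂ) ≠ 0 := ω.coe_ne_zero
  have e1 : z * conj (diskRotation ω a : ℂ) = ((ω⁻¹ : Circle) : ℂ) * z * conj (a : ℂ) := by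
    rw [coe_diskRotation, map_mul, Circle.coe_inv_eq_conj]
    ring
  have e2 : moebius (diskRotation ω a) z = ω * moebius a ((ω⁻¹ : Circle) * z) := by
    rw [moebius, moebius, e1, coe_diskRotation, Circle.coe_inv]
    field_simp
  rw [rot_apply, U_apply _ _ hz, U_apply _ _ ((smul_mem_ball _).2 hz), rot_apply,
    norm_diskRotation, e1, e2]

theorem U_symm_diskRotation (ω : Circle) (a : Disk) (f : FB η) :
    (U η (diskRotation ω a)).symm f = rot ω⁻¹ ((U η a).symm (rot ω f)) := by
  apply (U η (diskRotation ω a)).injective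
  rw [LinearIsometryEquiv.apply_symm_apply, U_diskRotation, rot_rot_inv,
    LinearIsometryEquiv.apply_symm_apply]
  have := rot_rot_inv ω⁻¹ f
  rw [inv_inv] at this
  exact this.symm

/-- On the right half-plane the principal powers are multiplicative, since the arguments of two
factors add up to less than `π`. -/
theorem mul_cpow_of_re_pos {x y : ℂ} (hx : 0 < x.re) (hy : 0 < y.re) (s : ℂ) :
    (x * y) ^ s = x ^ s * y ^ s := by
  have hx0 : x ≠ 0 := fun h => by simp [h] at hx
  have hy0 : y ≠ 0 := fun h => by simp [h] at hy
  have h1 := abs_lt.1 (Complex.abs_arg_lt_pi_div_two_iff.2 (Or.inl hx))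
  have h2 := abs_lt.1 (Complex.abs_arg_lt_pi_div_two_iff.2 (Or.inl hy))
  rw [Complex.cpow_def_of_ne_zero (mul_ne_zero hx0 hy0), Complex.cpow_def_of_ne_zero hx0,
    Complex.cpow_def_of_ne_zero hy0, Complex.log_mul hx0 hy0 ⟨by linarith, by linarith⟩, add_mul,
    Complex.exp_add]

/-- The operators `U(p(z))` form a projective representation up to rotations:
`U(p(z))† U(p(z'))` is a scalar times `U(p(p(z)⁻¹ · z'))` times a rotation. -/
theorem exists_U_symm_U (z z' : Disk) : ∃ (c : ℂ) (ω : Circle), ∀ f : FB η,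
    (U η z).symm (U η z' f) = c • U η (diskMoebius z z') (rot ω f) := by
  have hz := norm_coe_lt_one z
  have hz' := norm_coe_lt_one z'
  have hnz : ‖-(z : ℂ)‖ < 1 := by rwa [norm_neg]
  have hC := norm_coe_lt_one (diskMoebius z z')
  set D : ℂ := 1 - z * conj (z' : ℂ) with hD
  have hD0 : D ≠ 0 := den_ne_zero hz' hz
  have hDc : conj D = 1 - z' * conj (z : ℂ) := by
    simp only [hD, map_sub, map_one, map_mul, Complex.conj_conj]
    ring
  have hDc0 : conj D ≠ 0 := by rw [hDc]; exact den_ne_zero hz hz'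
  have hr : (((1 - ‖(diskMoebius z z' : ℂ)‖ ^ 2) ^ η : ℝ) : ℂ) ≠ 0 := by
    exact_mod_cast (Real.rpow_pos_of_pos (one_sub_norm_sq_pos _) _).ne'
  refine ⟨(((1 - ‖(z : ℂ)‖ ^ 2) ^ η : ℝ) : ℂ) * (((1 - ‖(z' : ℂ)‖ ^ 2) ^ η : ℝ) : ℂ) *
    D ^ (((-2 * η : ℝ)) : ℂ) / (((1 - ‖(diskMoebius z z' : ℂ)‖ ^ 2) ^ η : ℝ) : ℂ),
    Circle.ofConjDivSelf D hD0, fun f => FB.ext fun v hv => ?_⟩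
  have hv' : ‖v‖ < 1 := by simpa using hv
  have hm : ‖moebius (-z) v‖ < 1 := norm_moebius_lt hnz hv'
  set A : ℂ := 1 - v * conj (-z : ℂ) with hA
  set B : ℂ := 1 - moebius (-z) v * conj (z' : ℂ) with hB
  set E : ℂ := 1 - v * conj (diskMoebius z z' : ℂ) with hE
  have hA0 : A ≠ 0 := den_ne_zero hnz hv'
  have hB0 : B ≠ 0 := den_ne_zero hz' hm
  have hE0 : E ≠ 0 := den_ne_zero hC hv'
  have hmA : moebius (-z) v * A = v + z := by
    rw [moebius, ← hA, div_mul_cancel₀ _ hA0, sub_neg_eq_add]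
  have hCc : (diskMoebius z z' : ℂ) * conj D = z' - z := by
    rw [coe_diskMoebius, moebius, ← hDc, div_mul_cancel₀ _ hDc0]
  have hCD : conj (diskMoebius z z' : ℂ) * D = conj (z' : ℂ) - conj (z : ℂ) := by
    have := congrArg conj hCc
    simpa using this
  have hA' : A = 1 + v * conj (z : ℂ) := by rw [hA, map_neg]; ring
  -- Both products equal `1 + v z̄ - v z̄' - z z̄'`.
  have hABDE : A * B = D * E := by
    rw [hB, hE]
    linear_combination hA' - conj (z' : ℂ) * hmA + v * hCD - hD
  have hpow : A ^ (((-2 * η : ℝ)) : ℂ) * B ^ (((-2 * η : ℝ)) : ℂ) =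
      D ^ (((-2 * η : ℝ)) : ℂ) * E ^ (((-2 * η : ℝ)) : ℂ) := by
    rw [← mul_cpow_of_re_pos (re_den_pos hnz hv') (re_den_pos hz' hm), hABDE,
      mul_cpow_of_re_pos (re_den_pos hz' hz) (re_den_pos hC hv')]
  have harg : moebius z' (moebius (-z) v) =
      (Circle.ofConjDivSelf D hD0 : ℂ) * moebius (diskMoebius z z') v := by
    change (moebius (-z) v - z') / B = conj D / D * ((v - (diskMoebius z z' : ℂ)) / E)
    rw [div_mul_div_comm, div_eq_div_iff hB0 (mul_ne_zero hD0 hE0), ← hABDE]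
    linear_combination B * hmA - B * z' * hA' + B * hCc - B * v * hDc
  rw [FB.smul_apply, U_symm_apply _ _ hv, U_apply _ _ (mem_ball_zero_iff.2 hm), U_apply _ _ hv,
    rot_apply, harg]
  simp only [← hA, ← hB, ← hE]
  calc _ = (((1 - ‖(z : ℂ)‖ ^ 2) ^ η : ℝ) : ℂ) * (((1 - ‖(z' : ℂ)‖ ^ 2) ^ η : ℝ) : ℂ) *
        (A ^ (((-2 * η : ℝ)) : ℂ) * B ^ (((-2 * η : ℝ)) : ℂ)) *
        f ((Circle.ofConjDivSelf D hD0 : ℂ) * moebius (diskMoebius z z') v) := by ring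
    _ = _ := by
      rw [hpow]
      field_simp

/-! ### Operators that are diagonal in the monomial basis -/

/-- `M` is diagonal in the basis `e_n`. -/
def IsDiagonal (M : FB η →L[ℂ] FB η) : Prop :=
  ∀ m n, m ≠ n → inner ℂ (e η m) (M (e η n)) = 0

namespace IsDiagonal

variable {M : FB η →L[ℂ] FB η} (hM : IsDiagonal M)

include hM

theorem inner_e_apply (n : ℕ) (f : FB η) :
    inner ℂ (e η n) (M f) = inner ℂ (e η n) (M (e η n)) * inner ℂ (e η n) f := by
  have h := ((hasSum_inner_smul_e f).mapL M).mapL (innerSL ℂ (e η n))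
  simp only [map_smul, innerSL_apply_apply, smul_eq_mul] at h
  rw [← h.tsum_eq, tsum_eq_single n]
  · ring
  · intro k hk
    rw [hM n k hk.symm, mul_zero]

theorem apply_e (n : ℕ) : M (e η n) = inner ℂ (e η n) (M (e η n)) • e η n := by
  refine FB.ext_inner fun m => ?_
  rw [inner_smul_right, orthonormal_iff_ite.1 orthonormal_e]
  split_ifs with h
  · rw [h, mul_one]
  · rw [hM m n h, mul_zero]

theorem apply_rot (ω : Circle) (f : FB η) : M (rot ω f) = rot ω (M f) := by
  refine FB.ext_inner fun n => ?_
  rw [hM.inner_e_apply, inner_e_rot, inner_e_rot, hM.inner_e_apply n f]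
  ring

/-- A diagonal operator with real diagonal is symmetric. -/
theorem inner_symm (hr : ∀ n, conj (inner ℂ (e η n) (M (e η n))) = inner ℂ (e η n) (M (e η n)))
    (f g : FB η) : inner ℂ f (M g) = inner ℂ (M f) g := by
  rw [← (hasSum_inner_mul_inner_e f (M g)).tsum_eq, ← (hasSum_inner_mul_inner_e (M f) g).tsum_eq]
  refine tsum_congr fun n => ?_
  rw [hM.inner_e_apply, ← inner_conj_symm (M f), hM.inner_e_apply n f, map_mul, hr,
    inner_conj_symm]
  ring

theorem transport_diskRotation (ω : Circle) (t : Disk) (f : FB η) :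
    transport M (diskRotation ω t) f = rot ω⁻¹ (transport M t (rot ω f)) := by
  change U η (diskRotation ω t) (M ((U η (diskRotation ω t)).symm f)) =
    rot ω⁻¹ (U η t (M ((U η t).symm (rot ω f))))
  rw [U_symm_diskRotation, U_diskRotation, hM.apply_rot, rot_rot_inv]

/-- `M(p(z')) = U(p(z)) M(p(p(z)⁻¹ · z')) U(p(z))†`: the rotation in the composition law commutes
with `M` and the scalar cancels. -/
theorem transport_apply_U (z z' : Disk) (g : FB η) :
    transport M z' (U η z g) = U η z (transport M (diskMoebius z z') g) := by
  obtain ⟨c, ω, h⟩ := exists_U_symm_U (η := η) z z'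
  obtain ⟨f, rfl⟩ : ∃ f, g = (U η z).symm (U η z' f) :=
    ⟨(U η z').symm (U η z g), by simp⟩
  have h1 : transport M z' (U η z ((U η z).symm (U η z' f))) = U η z' (M f) := by
    simp [transport]
  have h2 : transport M (diskMoebius z z') ((U η z).symm (U η z' f)) =
      (U η z).symm (U η z' (M f)) := by
    rw [h, h, ← hM.apply_rot]
    simp [transport]
  rw [h1, h2, LinearIsometryEquiv.apply_symm_apply]

end IsDiagonal

/-- The overlap `tr (M₁(p(t)) M₂)`. -/
def overlap (M₁ M₂ : FB η →L[ℂ] FB η) (t : Disk) : ℂ := trace (transport M₁ t ∘L M₂)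

/-- Covariance: the overlap of two transported operators depends on the relative position only. -/
theorem trace_transport_comp_transport {M₁ M₂ : FB η →L[ℂ] FB η} (h₁ : IsDiagonal M₁)
    (h₂ : IsTraceClass M₂) (z z' : Disk) :
    trace (transport M₁ z' ∘L transport M₂ z) = overlap M₁ M₂ (diskMoebius z z') := by
  refine (h₂.comp_left (transport M₁ (diskMoebius z z'))).trace_conj (U η z) fun v => ?_
  have : transport M₂ z (U η z v) = U η z (M₂ v) := by simp [transport]
  rw [ContinuousLinearMap.comp_apply, this, h₁.transport_apply_U]
  rfl

theorem overlap_diskRotation {M₁ M₂ : FB η →L[ℂ] FB η} (h₁ : IsDiagonal M₁) (h₂ : IsDiagonal M₂)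
    (ω : Circle) (t : Disk) : overlap M₁ M₂ (diskRotation ω t) = overlap M₁ M₂ t := by
  refine tsum_congr fun n => ?_
  simp only [ContinuousLinearMap.comp_apply]
  rw [h₁.transport_diskRotation, inner_e_rot, ← h₂.apply_rot, rot_e, map_smul, map_smul,
    inner_smul_right, ← mul_assoc, ← mul_pow, ← Circle.coe_mul, inv_mul_cancel, Circle.coe_one,
    one_pow, one_mul]

theorem conj_overlap {M₁ M₂ : FB η →L[ℂ] FB η} (h₁ : IsDiagonal M₁) (h₂ : IsDiagonal M₂)
    (hr₁ : ∀ n, conj (inner ℂ (e η n) (M₁ (e η n))) = inner ℂ (e η n) (M₁ (e η n)))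
    (hr₂ : ∀ n, conj (inner ℂ (e η n) (M₂ (e η n))) = inner ℂ (e η n) (M₂ (e η n))) (t : Disk) :
    conj (overlap M₁ M₂ t) = overlap M₁ M₂ t := by
  rw [overlap, trace, Complex.conj_tsum]
  refine tsum_congr fun n => ?_
  simp only [ContinuousLinearMap.comp_apply]
  have hs : ∀ f g, inner ℂ f (transport M₁ t g) = inner ℂ (transport M₁ t f) g := fun f g => by
    obtain ⟨f, rfl⟩ := (U η t).surjective f
    obtain ⟨g, rfl⟩ := (U η t).surjective g
    simpa [transport] using h₁.inner_symm hr₁ f g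
  rw [h₂.apply_e n, map_smul, inner_smul_right, map_mul, hr₂, inner_conj_symm, hs]

/-! ### Quantizers are diagonal and symmetric -/

variable {w : ℝ → ℝ} {M : FB η →L[ℂ] FB η}

/-- The integral over the disk averages the off-diagonal matrix elements to zero. -/
theorem integral_inner_eq_zero (w : ℝ → ℝ) {m n : ℕ} (h : m ≠ n) :
    ∫ z : Disk, (w (‖(z : ℂ)‖ ^ 2) : ℂ) * inner ℂ (e η m) (U η z (parity η (e η n)))
      ∂hypMeasure = 0 := by
  obtain ⟨ω, hω⟩ := exists_circle_pow_eq_neg h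
  have key := (measurePreserving_diskRotation ω).integral_comp'
    (fun z : Disk => (w (‖(z : ℂ)‖ ^ 2) : ℂ) * inner ℂ (e η m) (U η z (parity η (e η n))))
  have h2 : ∀ z : Disk, (w (‖(diskRotation ω z : ℂ)‖ ^ 2) : ℂ) *
      inner ℂ (e η m) (U η (diskRotation ω z) (parity η (e η n))) =
      -((w (‖(z : ℂ)‖ ^ 2) : ℂ) * inner ℂ (e η m) (U η z (parity η (e η n)))) := fun z => by
    have h3 : rot ω ((-1 : ℂ) ^ n • e η n) = (ω : ℂ) ^ n • (-1 : ℂ) ^ n • e η n := by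
      rw [smul_comm, ← rot_e]
      rfl
    rw [norm_diskRotation, U_diskRotation, inner_e_rot, parity_e, h3, map_smul, inner_smul_right,
      Circle.coe_inv_eq_conj]
    linear_combination ((w (‖(z : ℂ)‖ ^ 2) : ℂ) *
      inner ℂ (e η m) (U η z ((-1 : ℂ) ^ n • e η n))) * hω
  simp only [h2, integral_neg] at key
  linear_combination (-1 / 2 : ℂ) * key

theorem IsQuantizer.isDiagonal (hM : IsQuantizer w M) : IsDiagonal M := fun m n h => by
  rw [hM.inner_eq, integral_inner_eq_zero w h, mul_zero]

/-- The rotation by half a turn. -/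
def halfTurn : Circle := Circle.exp Real.pi

theorem coe_halfTurn : (halfTurn : ℂ) = -1 := by
  rw [halfTurn, Circle.coe_exp, Complex.exp_pi_mul_I]

/-- `U(p(-z)) = U(p(z))†`. -/
theorem U_diskRotation_halfTurn (z : Disk) (f : FB η) :
    U η (diskRotation halfTurn z) f = (U η z).symm f := by
  refine FB.ext fun v hv => ?_
  rw [U_apply _ _ hv, U_symm_apply _ _ hv, norm_diskRotation, coe_diskRotation, coe_halfTurn,
    neg_one_mul]

/-- The diagonal of a quantizer is real: `⟨e_n | U(p(z)) e_n⟩` is the conjugate of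
`⟨e_n | U(p(-z)) e_n⟩` and depends on `|z|` only. -/
theorem IsQuantizer.conj_inner (hM : IsQuantizer w M) (n : ℕ) :
    conj (inner ℂ (e η n) (M (e η n))) = inner ℂ (e η n) (M (e η n)) := by
  rw [hM.inner_eq, map_mul, ← integral_conj, map_ofNat]
  congr 2
  funext z
  have h1 : conj (inner ℂ (e η n) (U η z (e η n))) = inner ℂ (e η n) (U η z (e η n)) := by
    rw [inner_conj_symm, ← (U η z).symm.inner_map_map, LinearIsometryEquiv.symm_apply_apply,
      ← U_diskRotation_halfTurn, U_diskRotation, inner_e_rot, rot_e, map_smul, inner_smul_right,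
      ← mul_assoc, ← mul_pow, ← Circle.coe_mul, inv_mul_cancel, Circle.coe_one, one_pow, one_mul]
  rw [map_mul, Complex.conj_ofReal, parity_e, map_smul, inner_smul_right, map_mul, h1]
  simp

end

section

/-! ### Covariance of the basic observables -/

theorem one_sub_norm_sq_ne_zero (z : Disk) : (1 : ℂ) - (‖(z : ℂ)‖ : ℂ) ^ 2 ≠ 0 := by
  exact_mod_cast (one_sub_norm_sq_pos z).ne'

/-- Moving `f` by a disk automorphism gives, up to odd terms, the multiple `f z` of `k₀`. The odd
terms are spanned by `t / (1 - |t|²)` and `t̄ / (1 - |t|²)`. -/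
def IsCovariantObservable (f : Disk → ℂ) : Prop :=
  ∀ z, ∃ b c : ℂ, ∀ t : Disk, f ((diskMoebius z).symm t) =
    f z * k0 t + (b * t + c * conj (t : ℂ)) / (1 - (‖(t : ℂ)‖ : ℂ) ^ 2)

theorem IsCovariantObservable.linear_comb {f g : Disk → ℂ} (hf : IsCovariantObservable f)
    (hg : IsCovariantObservable g) (p q : ℂ) : IsCovariantObservable fun z => p * f z + q * g z :=
  fun z => by
  obtain ⟨b, c, h⟩ := hf z
  obtain ⟨b', c', h'⟩ := hg z
  refine ⟨p * b + q * b', p * c + q * c', fun t => ?_⟩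
  simp only [h, h']
  ring

theorem one_sub_norm_sq_diskMoebius_symm (z t : Disk) :
    (1 : ℂ) - (‖((diskMoebius z).symm t : ℂ)‖ : ℂ) ^ 2 =
      (1 - (‖(z : ℂ)‖ : ℂ) ^ 2) * (1 - (‖(t : ℂ)‖ : ℂ) ^ 2) /
        ((1 + t * conj (z : ℂ)) * (1 + z * conj (t : ℂ))) := by
  have h := one_sub_normSq_moebius (a := -(z : ℂ)) (by rw [norm_neg]; exact norm_coe_lt_one z)
    (norm_coe_lt_one t)
  have h2 : ((‖1 - (t : ℂ) * conj (-z : ℂ)‖ ^ 2 : ℝ) : ℂ) =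
      (1 + t * conj (z : ℂ)) * (1 + z * conj (t : ℂ)) := by
    rw [← Complex.normSq_eq_norm_sq, ← Complex.mul_conj]
    simp only [map_sub, map_mul, map_neg, Complex.conj_conj, map_one]
    ring
  rw [← h2]
  rw [norm_neg] at h
  exact_mod_cast congrArg ((↑) : ℝ → ℂ) h

theorem one_add_mul_conj_ne_zero (z t : Disk) : 1 + (t : ℂ) * conj (z : ℂ) ≠ 0 := by
  have := den_ne_zero (a := -(z : ℂ)) (by rw [norm_neg]; exact norm_coe_lt_one z)
    (norm_coe_lt_one t)
  rwa [map_neg, mul_neg, sub_neg_eq_add] at this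

theorem coe_diskMoebius_symm (z t : Disk) :
    ((diskMoebius z).symm t : ℂ) = (t + z) / (1 + t * conj (z : ℂ)) := by
  change moebius (-z) t = _
  rw [moebius, map_neg, mul_neg, sub_neg_eq_add, sub_neg_eq_add]

theorem mul_conj_eq_norm_sq (z : ℂ) : z * conj z = (‖z‖ : ℂ) ^ 2 := Complex.mul_conj' z

theorem kMinus_eq (z : Disk) : kMinus z = 2 * z / (1 - (‖(z : ℂ)‖ : ℂ) ^ 2) := by
  rw [kMinus, k2, k1]
  field_simp
  ring

theorem kPlus_eq (z : Disk) : kPlus z = 2 * conj (z : ℂ) / (1 - (‖(z : ℂ)‖ : ℂ) ^ 2) := by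
  rw [kPlus, k2, k1]
  field_simp
  ring

theorem isCovariantObservable_kMinus : IsCovariantObservable kMinus := fun z => by
  refine ⟨2 / (1 - (‖(z : ℂ)‖ : ℂ) ^ 2), 2 * z ^ 2 / (1 - (‖(z : ℂ)‖ : ℂ) ^ 2), fun t => ?_⟩
  rw [kMinus_eq, kMinus_eq, one_sub_norm_sq_diskMoebius_symm, coe_diskMoebius_symm, k0]
  have h1 := one_sub_norm_sq_ne_zero z
  have h2 := one_sub_norm_sq_ne_zero t
  have h3 := one_add_mul_conj_ne_zero z t
  have h4 := one_add_mul_conj_ne_zero t z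
  field_simp
  rw [← mul_conj_eq_norm_sq (t : ℂ)]
  ring

theorem isCovariantObservable_kPlus : IsCovariantObservable kPlus := fun z => by
  refine ⟨2 * conj (z : ℂ) ^ 2 / (1 - (‖(z : ℂ)‖ : ℂ) ^ 2), 2 / (1 - (‖(z : ℂ)‖ : ℂ) ^ 2),
    fun t => ?_⟩
  rw [kPlus_eq, kPlus_eq, one_sub_norm_sq_diskMoebius_symm, coe_diskMoebius_symm, k0]
  have h1 := one_sub_norm_sq_ne_zero z
  have h2 := one_sub_norm_sq_ne_zero t
  have h3 := one_add_mul_conj_ne_zero z t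
  have h4 := one_add_mul_conj_ne_zero t z
  simp only [map_div₀, map_add, map_mul, map_one, Complex.conj_conj]
  have h5 : 1 + conj (t : ℂ) * z ≠ 0 := by rwa [mul_comm]
  field_simp
  rw [← mul_conj_eq_norm_sq (t : ℂ)]
  ring

theorem isCovariantObservable_k0 : IsCovariantObservable k0 := fun z => by
  refine ⟨2 * conj (z : ℂ) / (1 - (‖(z : ℂ)‖ : ℂ) ^ 2), 2 * z / (1 - (‖(z : ℂ)‖ : ℂ) ^ 2),
    fun t => ?_⟩
  have h1 := one_sub_norm_sq_ne_zero z
  have h2 := one_sub_norm_sq_ne_zero t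
  have h3 := one_add_mul_conj_ne_zero z t
  have h4 := one_add_mul_conj_ne_zero t z
  rw [k0, one_sub_norm_sq_diskMoebius_symm, ← mul_conj_eq_norm_sq, coe_diskMoebius_symm, k0, k0]
  simp only [map_div₀, map_add, map_mul, map_one, Complex.conj_conj]
  rw [mul_comm (conj (t : ℂ)) (z : ℂ)]
  field_simp
  rw [← mul_conj_eq_norm_sq (t : ℂ), ← mul_conj_eq_norm_sq (z : ℂ)]
  ring

theorem isCovariantObservable {f : Disk → ℂ} (hf : f ∈ basicObservables) :
    IsCovariantObservable f := by
  have h2 : k2 = fun z => (1 / 2 : ℂ) * kPlus z + (1 / 2 : ℂ) * kMinus z := by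
    funext z
    rw [kPlus, kMinus]
    ring
  have h1 : k1 = fun z => (Complex.I / 2) * kPlus z + (-Complex.I / 2) * kMinus z := by
    funext z
    rw [kPlus, kMinus]
    linear_combination k1 z * Complex.I_mul_I
  rcases hf with rfl | rfl | rfl | rfl | rfl
  · exact isCovariantObservable_k0
  · rw [h1]
    exact isCovariantObservable_kPlus.linear_comb isCovariantObservable_kMinus _ _
  · rw [h2]
    exact isCovariantObservable_kPlus.linear_comb isCovariantObservable_kMinus _ _
  · exact isCovariantObservable_kPlus
  · exact isCovariantObservable_kMinus

/-! ### The lower symbol -/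

theorem one_add_norm_sq_ne_zero (z : ℂ) : (1 : ℂ) + (‖z‖ : ℂ) ^ 2 ≠ 0 := by
  exact_mod_cast (by positivity : (0 : ℝ) < 1 + ‖z‖ ^ 2).ne'

/-- The odd terms are dominated by `k₀`, so the integrability of `k₀ φ` is all that is needed. -/
theorem norm_oddRatio_le (b c z : ℂ) (hz : ‖z‖ < 1) :
    ‖(b * z + c * conj z) / (1 + (‖z‖ : ℂ) ^ 2)‖ ≤ ‖b‖ + ‖c‖ := by
  have h1 : ‖(1 : ℂ) + (‖z‖ : ℂ) ^ 2‖ = 1 + ‖z‖ ^ 2 := by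
    have := Complex.norm_real (1 + ‖z‖ ^ 2)
    rw [Real.norm_of_nonneg (by positivity)] at this
    rw [← this]
    push_cast
    rfl
  rw [norm_div, h1, div_le_iff₀ (by positivity)]
  have h2 : ‖b * z + c * conj z‖ ≤ (‖b‖ + ‖c‖) * ‖z‖ := by
    refine (norm_add_le _ _).trans ?_
    rw [norm_mul, norm_mul, RCLike.norm_conj]
    linarith
  have h3 : (‖b‖ + ‖c‖) * ‖z‖ ≤ (‖b‖ + ‖c‖) * (1 + ‖z‖ ^ 2) := by
    gcongr
    nlinarith [sq_nonneg ‖z‖]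
  exact h2.trans h3

theorem k0_mul_oddRatio (b c : ℂ) (t : Disk) :
    (b * t + c * conj (t : ℂ)) / (1 - (‖(t : ℂ)‖ : ℂ) ^ 2) =
      (b * t + c * conj (t : ℂ)) / (1 + (‖(t : ℂ)‖ : ℂ) ^ 2) * k0 t := by
  have h1 := one_sub_norm_sq_ne_zero t
  have h2 := one_add_norm_sq_ne_zero t
  rw [k0]
  field_simp

theorem integrable_odd_mul {φ : Disk → ℂ} (hφ : Integrable (fun t => k0 t * φ t) hypMeasure)
    (b c : ℂ) : Integrable (fun t : Disk =>
      (b * t + c * conj (t : ℂ)) / (1 - (‖(t : ℂ)‖ : ℂ) ^ 2) * φ t) hypMeasure := by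
  have hm : Measurable fun t : Disk => (b * t + c * conj (t : ℂ)) / (1 + (‖(t : ℂ)‖ : ℂ) ^ 2) := by
    have h1 : Measurable fun z : ℂ => (b * z + c * conj z) / (1 + (‖z‖ : ℂ) ^ 2) := by
      have := Complex.continuous_conj.measurable
      have := Complex.measurable_ofReal.comp (measurable_norm (α := ℂ))
      fun_prop
    exact h1.comp measurable_subtype_coe
  refine (hφ.bdd_mul (c := ‖b‖ + ‖c‖) hm.aestronglyMeasurable (Eventually.of_forall fun t =>
    norm_oddRatio_le b c t (norm_coe_lt_one t))).congr (Eventually.of_forall fun t => ?_)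
  simp only [k0_mul_oddRatio]
  ring

theorem integral_odd_mul_eq_zero {φ : Disk → ℂ} (hφ : ∀ t, φ (diskRotation halfTurn t) = φ t)
    (b c : ℂ) : ∫ t : Disk, (b * t + c * conj (t : ℂ)) / (1 - (‖(t : ℂ)‖ : ℂ) ^ 2) * φ t
      ∂hypMeasure = 0 := by
  have key := (measurePreserving_diskRotation halfTurn).integral_comp' (fun t : Disk =>
    (b * t + c * conj (t : ℂ)) / (1 - (‖(t : ℂ)‖ : ℂ) ^ 2) * φ t)
  have h2 : ∀ t : Disk, (b * (diskRotation halfTurn t : ℂ) +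
      c * conj (diskRotation halfTurn t : ℂ)) / (1 - (‖(diskRotation halfTurn t : ℂ)‖ : ℂ) ^ 2) *
        φ (diskRotation halfTurn t) =
      -((b * t + c * conj (t : ℂ)) / (1 - (‖(t : ℂ)‖ : ℂ) ^ 2) * φ t) := fun t => by
    rw [hφ, norm_diskRotation, coe_diskRotation, coe_halfTurn, neg_one_mul, map_neg]
    ring
  simp only [h2, integral_neg] at key
  linear_combination (-1 / 2 : ℂ) * key

variable {η : ℝ} [hη : Fact (1 / 2 < η)]

/-- The factor by which quantization followed by the lower symbol multiplies the `k_a`. -/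
def symbolFactor (M₁ M₂ : FB η →L[ℂ] FB η) : ℂ :=
  (((2 * η - 1) / Real.pi : ℝ) : ℂ) * ∫ t, k0 t * overlap M₁ M₂ t ∂hypMeasure

section Covariance

variable {M₁ M₂ : FB η →L[ℂ] FB η} (h₁ : IsDiagonal M₁) (h₂ : IsDiagonal M₂)
  (ht : IsTraceClass M₂) (hi : Integrable (fun t => k0 t * overlap M₁ M₂ t) hypMeasure)
  {f : Disk → ℂ} (hf : f ∈ basicObservables) (z : Disk)

include h₁ ht

theorem symbolIntegrand_eq (f : Disk → ℂ) (z z' : Disk) : symbolIntegrand M₁ M₂ f z z' =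
    f ((diskMoebius z).symm (diskMoebius z z')) * overlap M₁ M₂ (diskMoebius z z') := by
  rw [symbolIntegrand, trace_transport_comp_transport h₁ ht, MeasurableEquiv.symm_apply_apply]

include hi hf

theorem integrable_symbolIntegrand : Integrable (symbolIntegrand M₁ M₂ f z) hypMeasure := by
  obtain ⟨b, c, h⟩ := isCovariantObservable hf z
  rw [funext (symbolIntegrand_eq h₁ ht f z)]
  refine ((measurePreserving_diskMoebius z).integrable_comp_emb
    (diskMoebius z).measurableEmbedding (g := fun t =>
      f ((diskMoebius z).symm t) * overlap M₁ M₂ t)).2 ?_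
  refine ((hi.const_mul (f z)).add (integrable_odd_mul hi b c)).congr
    (Eventually.of_forall fun t => ?_)
  simp only [h, Pi.add_apply]
  ring

include h₂

/-- The invariance of the measure moves the integration variable by `p(z)⁻¹`. What remains of the
observable is `f z * k0` and odd terms, which the even overlap integrates to zero. -/
theorem lowerSymbol_eq : lowerSymbol M₁ M₂ f z = symbolFactor M₁ M₂ * f z := by
  obtain ⟨b, c, h⟩ := isCovariantObservable hf z
  rw [lowerSymbol, funext (symbolIntegrand_eq h₁ ht f z),
    (measurePreserving_diskMoebius z).integral_comp' (fun t =>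
      f ((diskMoebius z).symm t) * overlap M₁ M₂ t)]
  have h3 : ∀ t, f ((diskMoebius z).symm t) * overlap M₁ M₂ t =
      f z * (k0 t * overlap M₁ M₂ t) +
        (b * t + c * conj (t : ℂ)) / (1 - (‖(t : ℂ)‖ : ℂ) ^ 2) * overlap M₁ M₂ t := fun t => by
    rw [h]
    ring
  rw [integral_congr_ae (Eventually.of_forall h3),
    integral_add (hi.const_mul (f z)) (integrable_odd_mul hi b c),
    integral_odd_mul_eq_zero (overlap_diskRotation h₁ h₂ halfTurn), integral_const_mul,
    symbolFactor]
  ring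

end Covariance

/-- The trace of `A_f M₂(p(z))` is the lower symbol when sum and integral may be exchanged. -/
theorem hasOperatorLowerSymbol_lowerSymbol {M₁ M₂ : FB η →L[ℂ] FB η} {f : Disk → ℂ} {z : Disk}
    (h : TraceConvergesAbsolutely M₁ M₂ f z) :
    HasOperatorLowerSymbol M₁ M₂ f z (lowerSymbol M₁ M₂ f z) := by
  have key := (hasSum_integral_of_summable_integral_norm h.1 h.2).mul_left
    (((2 * η - 1) / Real.pi : ℝ) : ℂ)
  simp only [tsum_mul_left] at key
  exact key

theorem conj_symbolFactor {M₁ M₂ : FB η →L[ℂ] FB η}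
    (hr : ∀ t, conj (overlap M₁ M₂ t) = overlap M₁ M₂ t) :
    conj (symbolFactor M₁ M₂) = symbolFactor M₁ M₂ := by
  have h0 : ∀ t : Disk, conj (k0 t) = k0 t := fun t => by simp [k0]
  rw [symbolFactor, map_mul, Complex.conj_ofReal, ← integral_conj]
  simp only [map_mul, h0, hr]

end

section

/-! ### The binomial series and a Chu-Vandermonde sum -/

theorem binomCoeff_eq_choose (s : ℝ) (k : ℕ) :
    Ring.choose ((s : ℂ) + k - 1) k = (binomCoeff s k : ℂ) := by
  have h1 : Ring.choose ((s : ℂ) + k - 1) k = ((Ring.choose (s + k - 1) k : ℝ) : ℂ) := by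
    push_cast
    rfl
  have h2 := Ring.factorial_nsmul_multichoose_eq_ascPochhammer s k
  rw [Polynomial.ascPochhammer_smeval_eq_eval, nsmul_eq_mul] at h2
  have h3 : Ring.choose (s + k - 1) k = Ring.multichoose s k := by
    rw [Ring.choose]
    congr 1
    ring
  rw [h1, h3, binomCoeff, ← h2, mul_div_cancel_left₀ _ (by positivity)]

theorem hasSum_binomCoeff (s : ℝ) {x : ℂ} (hx : ‖x‖ < 1) :
    HasSum (fun k => (binomCoeff s k : ℂ) * x ^ k) ((1 - x) ^ ((-s : ℝ) : ℂ)) := by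
  have h := (Complex.one_div_one_sub_cpow_hasFPowerSeriesOnBall_zero (s : ℂ)).hasSum (y := x)
    (by simpa [enorm_eq_nnnorm, ← NNReal.coe_lt_one] using hx)
  simp only [FormalMultilinearSeries.ofScalars_apply_eq, zero_add, smul_eq_mul, one_div,
    binomCoeff_eq_choose] at h
  rwa [Complex.ofReal_neg, Complex.cpow_neg]

/-- The Cauchy product of two power series. -/
theorem hasSum_mul_pow_of_hasSum {a b : ℕ → ℂ} {x A B : ℂ}
    (ha : HasSum (fun k => a k * x ^ k) A) (hb : HasSum (fun k => b k * x ^ k) B) :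
    HasSum (fun k => (∑ p ∈ Finset.HasAntidiagonal.antidiagonal k, a p.1 * b p.2) * x ^ k)
      (A * B) := by
  have e1 : ∀ k, (∑ p ∈ Finset.HasAntidiagonal.antidiagonal k, a p.1 * b p.2) * x ^ k =
      ∑ p ∈ Finset.HasAntidiagonal.antidiagonal k,
        (a p.1 * x ^ p.1) * (b p.2 * x ^ p.2) := fun k => by
    rw [Finset.sum_mul]
    refine Finset.sum_congr rfl fun p hp => ?_
    rw [← Finset.HasAntidiagonal.mem_antidiagonal.1 hp, pow_add]
    ring
  simp only [e1]
  rw [← ha.tsum_eq, ← hb.tsum_eq, tsum_mul_tsum_eq_tsum_sum_antidiagonal_of_summable_norm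
    ha.summable.norm hb.summable.norm]
  exact (summable_norm_sum_mul_antidiagonal_of_summable_norm ha.summable.norm
    hb.summable.norm).of_norm.hasSum

/-- For `n ≥ 1` the ratio `(x + n)_k / (x)_(k + 1)` is a polynomial in `k` of degree `n - 1`, so its
`n`-th difference vanishes. -/
theorem sum_choose_mul_ascPochhammer_div_eq_zero {x : ℝ} (hx : 0 < x) {n : ℕ} (hn : n ≠ 0) :
    ∑ k ∈ Finset.range (n + 1), (-1 : ℝ) ^ k * n.choose k *
      ((ascPochhammer ℝ k).eval (x + n) / (ascPochhammer ℝ (k + 1)).eval x) = 0 := by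
  obtain ⟨m, rfl⟩ := Nat.exists_eq_succ_of_ne_zero hn
  have hpos : ∀ j, (ascPochhammer ℝ j).eval x ≠ 0 := fun j => (ascPochhammer_pos j x hx).ne'
  set P : Polynomial ℝ := (ascPochhammer ℝ m).comp (Polynomial.X + Polynomial.C (x + 1)) with hP
  have hdeg : P.natDegree < m + 1 := by
    rw [hP, Polynomial.natDegree_comp, ascPochhammer_natDegree, Polynomial.natDegree_X_add_C,
      mul_one]
    exact m.lt_succ_self
  have hsplit : ∀ i j : ℕ, (ascPochhammer ℝ i).eval x * (ascPochhammer ℝ j).eval (x + i) =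
      (ascPochhammer ℝ (i + j)).eval x := fun i j => by
    rw [← ascPochhammer_mul]
    simp
  have hratio : ∀ k : ℕ, (ascPochhammer ℝ k).eval (x + (m + 1 : ℕ)) /
      (ascPochhammer ℝ (k + 1)).eval x = P.eval (k : ℝ) / (ascPochhammer ℝ (m + 1)).eval x := by
    intro k
    have h1 := hsplit (m + 1) k
    have h2 := hsplit (k + 1) m
    rw [show k + 1 + m = m + 1 + k by ring, ← h1] at h2
    have h3 : P.eval (k : ℝ) = (ascPochhammer ℝ m).eval (x + (k + 1 : ℕ)) := by
      rw [hP]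
      simp only [Polynomial.eval_comp, Polynomial.eval_add, Polynomial.eval_X, Polynomial.eval_C]
      congr 1
      push_cast
      ring
    rw [div_eq_div_iff (hpos _) (hpos _), h3]
    linarith
  have h := congrFun (Polynomial.fwdDiff_iter_eq_zero_of_degree_lt hdeg) 0
  rw [fwdDiff_iter_eq_sum_shift] at h
  simp only [hratio, ← mul_div_assoc, ← Finset.sum_div]
  refine div_eq_zero_iff.2 (Or.inl ?_)
  have h4 : ∀ k ∈ Finset.range (m + 1 + 1), (-1 : ℝ) ^ k * ((m + 1).choose k : ℝ) * P.eval (k : ℝ) =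
      (-1) ^ (m + 1) * (((-1 : ℤ) ^ (m + 1 - k) * (m + 1).choose k) •
        P.eval ((0 : ℝ) + k • (1 : ℝ))) := fun k hk => by
    have hk' : k ≤ m + 1 := Nat.lt_succ_iff.1 (Finset.mem_range.1 hk)
    have hs : (-1 : ℝ) ^ (m + 1) * (-1) ^ (m + 1 - k) = (-1) ^ k := by
      rw [← pow_add, show m + 1 + (m + 1 - k) = 2 * (m + 1 - k) + k by omega, pow_add, pow_mul]
      simp
    simp only [zsmul_eq_mul, nsmul_eq_mul, mul_one, zero_add]
    push_cast
    rw [← mul_assoc, ← mul_assoc, hs]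
  rw [Finset.sum_congr rfl h4, ← Finset.mul_sum, h]
  simp

variable {η : ℝ}

theorem perelomovWeight_mul_rpow (z : Disk) : perelomovWeight η (‖(z : ℂ)‖ ^ 2) *
    (1 - ‖(z : ℂ)‖ ^ 2) ^ η = η / Real.pi * (1 - ‖(z : ℂ)‖ ^ 2) ^ (2 * η + 1) := by
  rw [perelomovWeight, mul_assoc, ← Real.rpow_add (one_sub_norm_sq_pos z)]
  ring_nf

theorem normSqConst_zero : normSqConst η 0 = 1 := by simp [normSqConst, binomCoeff]

theorem summable_normSqConst_mul_pow {r : ℝ} (h0 : 0 ≤ r) (h1 : r < 1) :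
    Summable fun n => normSqConst η n * r ^ n := by
  have h := (hasSum_binomCoeff (2 * η) (x := (r : ℂ)) (by
    rwa [Complex.norm_real, Real.norm_of_nonneg h0])).summable
  exact_mod_cast h

variable [hη : Fact (1 / 2 < η)]

/-! ### Matrix elements of the representation -/

theorem sqrt_normSqConst_ne_zero (n : ℕ) : ((Real.sqrt (normSqConst η n) : ℝ) : ℂ) ≠ 0 := by
  exact_mod_cast (Real.sqrt_pos.2 (normSqConst_pos n)).ne'

theorem sqrt_normSqConst_mul_self (n : ℕ) : ((Real.sqrt (normSqConst η n) : ℝ) : ℂ) *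
    ((Real.sqrt (normSqConst η n) : ℝ) : ℂ) = (normSqConst η n : ℂ) := by
  exact_mod_cast congrArg ((↑) : ℝ → ℂ) (Real.mul_self_sqrt (normSqConst_pos (η := η) n).le)

theorem hasSum_choose_mul_pow (n : ℕ) (z v : ℂ) :
    HasSum (fun j => ((n.choose j : ℂ) * (-z) ^ (n - j)) * v ^ j) ((v - z) ^ n) := by
  have h : (v - z) ^ n = ∑ j ∈ Finset.range (n + 1),
      ((n.choose j : ℂ) * (-z) ^ (n - j)) * v ^ j := by
    rw [sub_eq_add_neg, add_pow]
    refine Finset.sum_congr rfl fun j _ => ?_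
    ring
  rw [h]
  refine hasSum_sum_of_ne_finset_zero fun j hj => ?_
  rw [Nat.choose_eq_zero_of_lt (by simpa using hj)]
  simp

theorem U_e_apply (z : Disk) (n : ℕ) {v : ℂ} (hv : v ∈ Metric.ball (0 : ℂ) 1) :
    U η z (e η n) v = (((1 - ‖(z : ℂ)‖ ^ 2) ^ η : ℝ) : ℂ) *
      ((Real.sqrt (normSqConst η n) : ℝ) : ℂ) *
      ((1 - v * conj (z : ℂ)) ^ ((-(2 * η + n) : ℝ) : ℂ) * (v - z) ^ n) := by
  have hv' : ‖v‖ < 1 := by simpa using hv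
  have hd := den_ne_zero (norm_coe_lt_one z) hv'
  rw [U_apply _ _ hv, e_apply _ (mem_ball_zero_iff.2 (norm_moebius_lt (norm_coe_lt_one z) hv')),
    moebius, div_pow, show (((-(2 * η + n) : ℝ)) : ℂ) = ((-2 * η : ℝ) : ℂ) - (n : ℕ) by
      push_cast; ring, Complex.cpow_sub _ _ hd, Complex.cpow_natCast]
  field_simp

/-- The matrix elements of `U(p(z))`. -/
theorem inner_e_U_e (z : Disk) (m n : ℕ) : inner ℂ (e η m) (U η z (e η n)) =
    (((1 - ‖(z : ℂ)‖ ^ 2) ^ η : ℝ) : ℂ) * ((Real.sqrt (normSqConst η n) : ℝ) : ℂ) *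
      (∑ p ∈ Finset.HasAntidiagonal.antidiagonal m,
        ((binomCoeff (2 * η + n) p.1 : ℂ) * conj (z : ℂ) ^ p.1) *
        ((n.choose p.2 : ℂ) * (-z : ℂ) ^ (n - p.2))) /
      ((Real.sqrt (normSqConst η m) : ℝ) : ℂ) := by
  refine inner_e_eq (a := fun m => (((1 - ‖(z : ℂ)‖ ^ 2) ^ η : ℝ) : ℂ) *
    ((Real.sqrt (normSqConst η n) : ℝ) : ℂ) *
      (∑ p ∈ Finset.HasAntidiagonal.antidiagonal m,
        ((binomCoeff (2 * η + n) p.1 : ℂ) * conj (z : ℂ) ^ p.1) *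
        ((n.choose p.2 : ℂ) * (-z : ℂ) ^ (n - p.2)))) (fun v hv => ?_) m
  rw [U_e_apply z n hv]
  have hv' : ‖v * conj (z : ℂ)‖ < 1 := by
    rw [norm_mul, RCLike.norm_conj]
    have := norm_coe_lt_one z
    have hv1 : ‖v‖ < 1 := by simpa using hv
    nlinarith [norm_nonneg v, norm_nonneg (z : ℂ)]
  have h1 : HasSum (fun k => ((binomCoeff (2 * η + n) k : ℂ) * conj (z : ℂ) ^ k) * v ^ k)
      ((1 - v * conj (z : ℂ)) ^ ((-(2 * η + n) : ℝ) : ℂ)) := by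
    refine (hasSum_binomCoeff (2 * η + n) hv').congr_fun fun k => ?_
    rw [mul_pow]
    ring
  refine ((hasSum_mul_pow_of_hasSum h1 (hasSum_choose_mul_pow n z v)).mul_left _).congr_fun
    fun k => ?_
  ring

/-- The diagonal matrix elements of `U(p(z))` are Jacobi polynomials in `|z|²`, up to a power of
`1 - |z|²`. -/
theorem inner_e_U_e_self (z : Disk) (n : ℕ) : inner ℂ (e η n) (U η z (e η n)) =
    ((∑ k ∈ Finset.range (n + 1), (-1) ^ k * n.choose k * binomCoeff (2 * η + n) k *
      ((‖(z : ℂ)‖ ^ 2) ^ k * (1 - ‖(z : ℂ)‖ ^ 2) ^ η) : ℝ) : ℂ) := by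
  have hN := sqrt_normSqConst_ne_zero (η := η) n
  rw [inner_e_U_e, Finset.Nat.sum_antidiagonal_eq_sum_range_succ_mk, mul_right_comm,
    mul_div_cancel_right₀ _ hN, Finset.mul_sum]
  push_cast
  refine Finset.sum_congr rfl fun k hk => ?_
  have hk' : k ≤ n := Nat.lt_succ_iff.1 (Finset.mem_range.1 hk)
  rw [Nat.sub_sub_self hk', Nat.choose_symm hk', ← mul_conj_eq_norm_sq, mul_pow, neg_pow]
  ring

/-! ### The Perelomov quantizer -/

/-- The projection `|e₀⟩⟨e₀|` on the lowest state. -/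
def groundProjection (η : ℝ) [hη : Fact (1 / 2 < η)] : FB η →L[ℂ] FB η :=
  (innerSL ℂ (e η 0)).smulRight (e η 0)

theorem groundProjection_apply (f : FB η) :
    groundProjection η f = inner ℂ (e η 0) f • e η 0 := rfl

theorem inner_e_e (m n : ℕ) : inner ℂ (e η m) (e η n) = if m = n then (1 : ℂ) else 0 :=
  orthonormal_iff_ite.1 orthonormal_e m n

theorem inner_e_groundProjection_e (m n : ℕ) :
    inner ℂ (e η m) (groundProjection η (e η n)) = if m = 0 ∧ n = 0 then (1 : ℂ) else 0 := by
  rw [groundProjection_apply, inner_smul_right, inner_e_e, inner_e_e]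
  by_cases hm : m = 0 <;> by_cases hn : n = 0 <;> simp [hm, hn, eq_comm]

theorem isTraceClass_groundProjection : IsTraceClass (groundProjection η) := by
  refine ⟨Pi.single 0 (e η 0), Pi.single 0 (e η 0), ?_, fun v => ?_⟩
  · refine summable_of_ne_finset_zero (s := {0}) fun k hk => ?_
    rw [Pi.single_eq_of_ne (by simpa using hk), norm_zero, zero_mul]
  · have := hasSum_single (f := fun k => inner ℂ ((Pi.single 0 (e η 0) : ℕ → FB η) k) v •
      (Pi.single 0 (e η 0) : ℕ → FB η) k) 0 fun k hk => by
        simp only [Pi.single_eq_of_ne hk, smul_zero]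
    simpa [groundProjection_apply] using this

theorem trace_groundProjection : trace (groundProjection η) = 1 := by
  simp only [trace, inner_e_groundProjection_e, and_self]
  rw [tsum_ite_eq]

theorem integrable_norm_sq_pow_mul_rpow {s : ℝ} (hs : 1 < s) (k : ℕ) :
    Integrable (fun z : Disk => (‖(z : ℂ)‖ ^ 2) ^ k * (1 - ‖(z : ℂ)‖ ^ 2) ^ s) hypMeasure := by
  refine (integrable_one_sub_norm_sq_rpow hs).bdd_mul (c := 1) ?_ (Eventually.of_forall fun z => ?_)
  · exact (by fun_prop : Measurable fun z : Disk => (‖(z : ℂ)‖ ^ 2) ^ k).aestronglyMeasurable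
  · rw [norm_pow, norm_pow, norm_norm]
    exact pow_le_one₀ (by positivity) (pow_le_one₀ (norm_nonneg _) (norm_coe_lt_one z).le)

/-- The weight `(1 - u)^(η + 1)` is orthogonal to all but the lowest diagonal matrix element:
term-by-term Beta integrals lead to the Chu-Vandermonde sum above. -/
theorem integral_perelomovWeight_mul_inner (n : ℕ) :
    2 * ∫ z : Disk, (perelomovWeight η (‖(z : ℂ)‖ ^ 2) : ℂ) *
      inner ℂ (e η n) (U η z (parity η (e η n))) ∂hypMeasure = if n = 0 then (1 : ℂ) else 0 := by
  have h := hη.out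
  have h0 : 0 < 2 * η := two_eta_pos
  have hs : 1 < 2 * η + 1 := by linarith
  have e1 : ∀ z : Disk, (perelomovWeight η (‖(z : ℂ)‖ ^ 2) : ℂ) *
      inner ℂ (e η n) (U η z (parity η (e η n))) =
      ((∑ k ∈ Finset.range (n + 1), ((-1) ^ n * (η / Real.pi) *
        ((-1) ^ k * n.choose k * binomCoeff (2 * η + n) k)) *
        ((‖(z : ℂ)‖ ^ 2) ^ k * (1 - ‖(z : ℂ)‖ ^ 2) ^ (2 * η + 1)) : ℝ) : ℂ) := fun z => by
    rw [parity_e, map_smul, inner_smul_right, inner_e_U_e_self,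
      show ((-1 : ℂ) ^ n) = (((-1 : ℝ) ^ n : ℝ) : ℂ) by push_cast; rfl, ← Complex.ofReal_mul,
      ← Complex.ofReal_mul, ← mul_assoc, Finset.mul_sum]
    congr 1
    refine Finset.sum_congr rfl fun k _ => ?_
    linear_combination ((-1) ^ n * ((-1) ^ k * n.choose k * binomCoeff (2 * η + n) k) *
      (‖(z : ℂ)‖ ^ 2) ^ k) * perelomovWeight_mul_rpow (η := η) z
  rw [integral_congr_ae (Eventually.of_forall e1), integral_complex_ofReal,
    integral_finsetSum _ fun k _ => (integrable_norm_sq_pow_mul_rpow hs k).const_mul _]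
  simp only [integral_const_mul, integral_norm_sq_pow_mul_rpow hs, add_sub_cancel_right]
  have e2 : ∀ k, ((-1) ^ n * (η / Real.pi) * ((-1) ^ k * n.choose k * binomCoeff (2 * η + n) k)) *
      (Real.pi * (k.factorial / (ascPochhammer ℝ (k + 1)).eval (2 * η))) =
      ((-1) ^ n * η) * ((-1) ^ k * n.choose k * ((ascPochhammer ℝ k).eval (2 * η + n) /
        (ascPochhammer ℝ (k + 1)).eval (2 * η))) := fun k => by
    have hπ := Real.pi_pos.ne'
    have hk : (k.factorial : ℝ) ≠ 0 := by positivity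
    have hp := (ascPochhammer_pos (k + 1) (2 * η) h0).ne'
    rw [binomCoeff]
    field_simp
  rw [Finset.sum_congr rfl fun k _ => e2 k, ← Finset.mul_sum]
  split_ifs with hn
  · subst hn
    have hη0 : η ≠ 0 := by linarith
    have h2 : ∑ k ∈ Finset.range (0 + 1), (-1 : ℝ) ^ k * (0 : ℕ).choose k *
        ((ascPochhammer ℝ k).eval (2 * η + (0 : ℕ)) / (ascPochhammer ℝ (k + 1)).eval (2 * η)) =
        (2 * η)⁻¹ := by simp
    rw [h2, pow_zero, one_mul, mul_inv, mul_left_comm, mul_inv_cancel₀ hη0]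
    norm_num
  · rw [sum_choose_mul_ascPochhammer_div_eq_zero h0 hn]
    simp

theorem measurable_inner_e_U_e (m n : ℕ) :
    Measurable fun z : Disk => inner ℂ (e η m) (U η z (e η n)) := by
  simp only [inner_e_U_e]
  have hc : Measurable fun z : Disk => conj (z : ℂ) :=
    Complex.continuous_conj.measurable.comp measurable_subtype_coe
  have hr : Measurable fun z : Disk => (((1 - ‖(z : ℂ)‖ ^ 2) ^ η : ℝ) : ℂ) :=
    Complex.measurable_ofReal.comp (by fun_prop)
  fun_prop

theorem norm_e (n : ℕ) : ‖e η n‖ = 1 := orthonormal_e.1 n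

theorem isQuantizer_groundProjection :
    IsQuantizer (perelomovWeight η) (groundProjection η) where
  integrable m n := by
    have h := hη.out
    have hw : Integrable (fun z : Disk => perelomovWeight η (‖(z : ℂ)‖ ^ 2)) hypMeasure :=
      (integrable_one_sub_norm_sq_rpow (s := η + 1) (by linarith)).const_mul _
    have hm : Measurable fun z : Disk => inner ℂ (e η m) (U η z (parity η (e η n))) := by
      simp only [parity_e, map_smul, inner_smul_right]
      exact (measurable_inner_e_U_e m n).const_mul _
    refine hw.ofReal.mul_bdd (c := 1) hm.aestronglyMeasurable (Eventually.of_forall fun z => ?_)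
    refine (norm_inner_le_norm _ _).trans ?_
    rw [LinearIsometryEquiv.norm_map, parity_e, norm_smul, norm_e, norm_e]
    simp
  inner_eq m n := by
    rw [inner_e_groundProjection_e]
    by_cases h : m = n
    · subst h
      rw [integral_perelomovWeight_mul_inner]
      simp
    · rw [integral_inner_eq_zero _ h, mul_zero, if_neg (by omega)]
  traceClass := isTraceClass_groundProjection
  trace_eq_one := trace_groundProjection

/-- A diagonal operator is determined by its matrix elements, hence by the weight. -/
theorem IsQuantizer.unique {w : ℝ → ℝ} {M M' : FB η →L[ℂ] FB η} (h : IsQuantizer w M)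
    (h' : IsQuantizer w M') : M = M' := by
  refine ContinuousLinearMap.ext fun f => FB.ext_inner fun n => ?_
  rw [h.isDiagonal.inner_e_apply, h'.isDiagonal.inner_e_apply n f, h.inner_eq, h'.inner_eq]

/-! ### Coherent states and the Perelomov factor -/

theorem inner_e_zero (f : FB η) : inner ℂ (e η 0) f = f 0 := by
  have h := hasSum_e f 0 (by simp)
  rw [← h.tsum_eq, tsum_eq_single 0 fun k hk => by simp [hk]]
  simp [normSqConst_zero]

theorem e_zero_apply {v : ℂ} (hv : v ∈ Metric.ball (0 : ℂ) 1) : e η 0 v = 1 := by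
  rw [e_apply 0 hv, normSqConst_zero]
  simp

/-- The coefficients of the coherent state `U(p(z)) e₀`. -/
theorem inner_e_coherent (z : Disk) (n : ℕ) : inner ℂ (e η n) (U η z (e η 0)) =
    (((1 - ‖(z : ℂ)‖ ^ 2) ^ η : ℝ) : ℂ) * ((Real.sqrt (normSqConst η n) : ℝ) : ℂ) *
      conj (z : ℂ) ^ n := by
  have hN := sqrt_normSqConst_ne_zero (η := η) n
  have hb : (binomCoeff (2 * η) n : ℂ) = ((Real.sqrt (normSqConst η n) : ℝ) : ℂ) *
      ((Real.sqrt (normSqConst η n) : ℝ) : ℂ) := (sqrt_normSqConst_mul_self n).symm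
  rw [inner_e_U_e, Finset.sum_eq_single_of_mem (n, 0) (by simp), normSqConst_zero]
  · simp only [Nat.cast_zero, add_zero, hb]
    simp
    field_simp
  · rintro ⟨i, j⟩ hp hne
    have hj : j ≠ 0 := fun h => hne (by
      have := Finset.HasAntidiagonal.mem_antidiagonal.1 hp
      simp only at this
      subst h
      simp [← this])
    simp [Nat.choose_eq_zero_of_lt (Nat.pos_of_ne_zero hj)]

/-- The reproducing property of the coherent states `U(p(z)) e₀`. -/
theorem inner_coherent (z : Disk) (f : FB η) : inner ℂ (U η z (e η 0)) f =
    (((1 - ‖(z : ℂ)‖ ^ 2) ^ η : ℝ) : ℂ) * f z := by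
  rw [← (U η z).symm.inner_map_map, LinearIsometryEquiv.symm_apply_apply, inner_e_zero,
    U_symm_apply _ _ (by simp), moebius]
  simp

theorem transport_groundProjection_apply (z : Disk) (f : FB η) :
    transport (groundProjection η) z f = inner ℂ (U η z (e η 0)) f • U η z (e η 0) := by
  rw [← (U η z).symm.inner_map_map, LinearIsometryEquiv.symm_apply_apply]
  simp [transport, groundProjection_apply]

theorem coherent_zero (t : Disk) :
    U η t (e η 0) 0 = (((1 - ‖(t : ℂ)‖ ^ 2) ^ η : ℝ) : ℂ) := by
  have := inner_e_coherent (η := η) t 0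
  rw [inner_e_zero, normSqConst_zero] at this
  simpa using this

/-- The squared overlap of two coherent states. -/
theorem overlap_groundProjection (t : Disk) :
    overlap (groundProjection η) (groundProjection η) t =
      (((1 - ‖(t : ℂ)‖ ^ 2) ^ (2 * η) : ℝ) : ℂ) := by
  rw [overlap, trace, tsum_eq_single 0]
  · rw [ContinuousLinearMap.comp_apply, groundProjection_apply, inner_e_e, if_pos rfl, one_smul,
      transport_groundProjection_apply, inner_smul_right, inner_coherent,
      e_zero_apply t.2, inner_e_zero, coherent_zero, mul_one, ← Complex.ofReal_mul,
      ← Real.rpow_add (one_sub_norm_sq_pos t), two_mul]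
  · intro n hn
    rw [ContinuousLinearMap.comp_apply, groundProjection_apply, inner_e_e, if_neg hn.symm,
      zero_smul, map_zero, inner_zero_right]

theorem k0_mul_overlap_groundProjection (t : Disk) :
    k0 t * overlap (groundProjection η) (groundProjection η) t =
      ((2 * (1 - ‖(t : ℂ)‖ ^ 2) ^ (2 * η - 1) - (1 - ‖(t : ℂ)‖ ^ 2) ^ (2 * η) : ℝ) : ℂ) := by
  have hp := one_sub_norm_sq_pos t
  have h1 : k0 t = (((1 + ‖(t : ℂ)‖ ^ 2) / (1 - ‖(t : ℂ)‖ ^ 2) : ℝ) : ℂ) := by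
    rw [k0]
    push_cast
    rfl
  rw [h1, overlap_groundProjection, ← Complex.ofReal_mul, Real.rpow_sub_one hp.ne']
  congr 1
  field_simp
  ring

theorem integrable_k0_mul_overlap_groundProjection (h1 : 1 < η) :
    Integrable (fun t => k0 t * overlap (groundProjection η) (groundProjection η) t)
      hypMeasure := by
  simp only [k0_mul_overlap_groundProjection]
  exact (((integrable_one_sub_norm_sq_rpow (by linarith)).const_mul 2).sub
    (integrable_one_sub_norm_sq_rpow (by linarith))).ofReal

theorem integral_rpow_hypMeasure {s : ℝ} (hs : 1 < s) :
    ∫ z : Disk, (1 - ‖(z : ℂ)‖ ^ 2) ^ s ∂hypMeasure = Real.pi / (s - 1) := by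
  have := integral_norm_sq_pow_mul_rpow hs 0
  simpa [div_eq_mul_inv] using this

theorem symbolFactor_groundProjection (h1 : 1 < η) :
    symbolFactor (groundProjection η) (groundProjection η) = ((η / (η - 1) : ℝ) : ℂ) := by
  have a1 : 1 < 2 * η - 1 := by linarith
  have a2 : 1 < 2 * η := by linarith
  rw [symbolFactor]
  simp only [k0_mul_overlap_groundProjection]
  rw [integral_complex_ofReal, integral_sub ((integrable_one_sub_norm_sq_rpow a1).const_mul 2)
    (integrable_one_sub_norm_sq_rpow a2), integral_const_mul, integral_rpow_hypMeasure a1,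
    integral_rpow_hypMeasure a2, ← Complex.ofReal_mul]
  congr 1
  have b1 : η - 1 ≠ 0 := by linarith
  have b2 : 2 * η - 1 ≠ 0 := by linarith
  have b3 : 2 * η - 1 - 1 ≠ 0 := by linarith
  have b4 := Real.pi_pos.ne'
  field_simp
  ring

theorem norm_coherent_le (z t : Disk) :
    ‖U η z (e η 0) t‖ ≤ (1 - ‖(z : ℂ)‖) ^ (-2 * η) := by
  have h := hη.out
  have hz := norm_coe_lt_one z
  have ht := norm_coe_lt_one t
  have hle : 1 - ‖(z : ℂ)‖ ≤ ‖1 - (t : ℂ) * conj (z : ℂ)‖ := by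
    have h1 := norm_sub_norm_le (1 : ℂ) (t * conj (z : ℂ))
    rw [norm_one, norm_mul, RCLike.norm_conj] at h1
    nlinarith [norm_nonneg (z : ℂ)]
  have hp := one_sub_norm_sq_pos z
  rw [U_apply _ _ t.2, e_zero_apply (mem_ball_zero_iff.2 (norm_moebius_lt hz ht)), mul_one,
    norm_mul, Complex.norm_cpow_real, Complex.norm_real,
    Real.norm_of_nonneg (Real.rpow_nonneg hp.le _)]
  calc _ ≤ 1 * (1 - ‖(z : ℂ)‖) ^ (-2 * η) := by
        gcongr ?_ * ?_
        · exact Real.rpow_le_one hp.le (by nlinarith [norm_nonneg (z : ℂ)]) (by linarith)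
        · exact Real.rpow_le_rpow_of_nonpos (by linarith) hle (by linarith)
    _ = _ := one_mul _

theorem exists_basicObservable_form {f : Disk → ℂ} (hf : f ∈ basicObservables) :
    ∃ a b c : ℂ, ∀ t : Disk, f t =
      (a * (1 + (‖(t : ℂ)‖ : ℂ) ^ 2) + b * t + c * conj (t : ℂ)) /
        (1 - (‖(t : ℂ)‖ : ℂ) ^ 2) := by
  obtain ⟨b, c, h⟩ := isCovariantObservable hf ⟨0, by simp⟩
  refine ⟨f ⟨0, by simp⟩, b, c, fun t => ?_⟩
  have h0 : (diskMoebius ⟨0, by simp⟩).symm t = t := by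
    refine Subtype.ext ?_
    rw [coe_diskMoebius_symm]
    simp
  have := h t
  rw [h0, k0] at this
  rw [this]
  ring

theorem measurable_basicObservable {f : Disk → ℂ} (hf : f ∈ basicObservables) :
    Measurable f := by
  obtain ⟨a, b, c, h⟩ := exists_basicObservable_form hf
  rw [funext h]
  have h1 : Measurable fun t : Disk => conj (t : ℂ) :=
    Complex.continuous_conj.measurable.comp measurable_subtype_coe
  have h2 : Measurable fun t : Disk => (‖(t : ℂ)‖ : ℂ) :=
    Complex.measurable_ofReal.comp (by fun_prop)
  fun_prop

theorem exists_norm_basicObservable_le {f : Disk → ℂ} (hf : f ∈ basicObservables) :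
    ∃ K, 0 ≤ K ∧ ∀ t : Disk, ‖f t‖ ≤ K * (1 - ‖(t : ℂ)‖ ^ 2)⁻¹ := by
  obtain ⟨a, b, c, h⟩ := exists_basicObservable_form hf
  refine ⟨‖a‖ * 2 + ‖b‖ + ‖c‖, by positivity, fun t => ?_⟩
  have hp := one_sub_norm_sq_pos t
  have ht := norm_coe_lt_one t
  have h1 : ‖(1 : ℂ) - (‖(t : ℂ)‖ : ℂ) ^ 2‖ = 1 - ‖(t : ℂ)‖ ^ 2 := by
    have := Complex.norm_real (1 - ‖(t : ℂ)‖ ^ 2)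
    rw [Real.norm_of_nonneg hp.le] at this
    rw [← this]
    push_cast
    rfl
  have h2 : ‖(1 : ℂ) + (‖(t : ℂ)‖ : ℂ) ^ 2‖ ≤ 2 := by
    refine (norm_add_le _ _).trans ?_
    rw [norm_one, norm_pow, Complex.norm_real, norm_norm]
    linarith
  rw [h, norm_div, h1, div_eq_mul_inv]
  gcongr
  refine (norm_add₃_le).trans ?_
  rw [norm_mul, norm_mul, norm_mul, RCLike.norm_conj]
  gcongr
  · exact mul_le_of_le_one_right (norm_nonneg _) ht.le
  · exact mul_le_of_le_one_right (norm_nonneg _) ht.le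

/-- For `η > 1` the factor `(1 - |z'|²)^(2η)` coming from the two coherent-state overlaps
compensates the growth of the observable, uniformly in the basis index up to a summable
sequence. -/
theorem traceConvergesAbsolutely_groundProjection (h1 : 1 < η) {f : Disk → ℂ}
    (hf : f ∈ basicObservables) (z : Disk) :
    TraceConvergesAbsolutely (groundProjection η) (groundProjection η) f z := by
  obtain ⟨K, hK0, hK⟩ := exists_norm_basicObservable_le hf
  set D : ℝ := (1 - ‖(z : ℂ)‖) ^ (-2 * η) with hD
  have hz := norm_coe_lt_one z
  have hD0 : 0 ≤ D := Real.rpow_nonneg (by linarith) _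
  have hform : ∀ (n : ℕ) (t : Disk), f t * inner ℂ (e η n) (transport (groundProjection η) t
      (transport (groundProjection η) z (e η n))) =
      f t * ((((1 - ‖(z : ℂ)‖ ^ 2) ^ η : ℝ) : ℂ) * e η n z *
        ((((1 - ‖(t : ℂ)‖ ^ 2) ^ η : ℝ) : ℂ) * U η z (e η 0) t *
        ((((1 - ‖(t : ℂ)‖ ^ 2) ^ η : ℝ) : ℂ) * ((Real.sqrt (normSqConst η n) : ℝ) : ℂ) *
          conj (t : ℂ) ^ n))) := fun n t => by
    rw [transport_groundProjection_apply z, map_smul, inner_smul_right, inner_coherent,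
      transport_groundProjection_apply, inner_smul_right, inner_coherent, inner_e_coherent]
  have hbound : ∀ (n : ℕ) (t : Disk), ‖f t * inner ℂ (e η n) (transport (groundProjection η) t
      (transport (groundProjection η) z (e η n)))‖ ≤
      (K * D * (normSqConst η n * ‖(z : ℂ)‖ ^ n)) * (1 - ‖(t : ℂ)‖ ^ 2) ^ (2 * η - 1) := by
    intro n t
    have hp := one_sub_norm_sq_pos t
    have hpz := one_sub_norm_sq_pos z
    have hN : Real.sqrt (normSqConst η n) * Real.sqrt (normSqConst η n) = normSqConst η n :=
      Real.mul_self_sqrt (normSqConst_pos n).le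
    have hz1 : (1 - ‖(z : ℂ)‖ ^ 2) ^ η ≤ 1 :=
      Real.rpow_le_one hpz.le (by nlinarith [norm_nonneg (z : ℂ)]) (by linarith)
    have ht1 : ‖(t : ℂ)‖ ^ n ≤ 1 := pow_le_one₀ (norm_nonneg _) (norm_coe_lt_one t).le
    have hpow : (1 - ‖(t : ℂ)‖ ^ 2)⁻¹ * ((1 - ‖(t : ℂ)‖ ^ 2) ^ η * (1 - ‖(t : ℂ)‖ ^ 2) ^ η) =
        (1 - ‖(t : ℂ)‖ ^ 2) ^ (2 * η - 1) := by
      rw [← Real.rpow_add hp, Real.rpow_sub_one hp.ne', two_mul]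
      ring
    rw [hform, e_apply n z.2]
    simp only [norm_mul, norm_pow, RCLike.norm_conj, Complex.norm_real]
    rw [Real.norm_of_nonneg (Real.rpow_nonneg hp.le _),
      Real.norm_of_nonneg (Real.rpow_nonneg hpz.le _), Real.norm_of_nonneg (Real.sqrt_nonneg _)]
    have hU := norm_coherent_le (η := η) z t
    have hf' := hK t
    have hr := Real.rpow_nonneg hp.le η
    calc _ ≤ (K * (1 - ‖(t : ℂ)‖ ^ 2)⁻¹) * (1 * (Real.sqrt (normSqConst η n) * ‖(z : ℂ)‖ ^ n) *
          ((1 - ‖(t : ℂ)‖ ^ 2) ^ η * D *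
            ((1 - ‖(t : ℂ)‖ ^ 2) ^ η * Real.sqrt (normSqConst η n) * 1))) := by gcongr
      _ = (K * D * ((Real.sqrt (normSqConst η n) * Real.sqrt (normSqConst η n)) *
          ‖(z : ℂ)‖ ^ n)) * ((1 - ‖(t : ℂ)‖ ^ 2)⁻¹ *
            ((1 - ‖(t : ℂ)‖ ^ 2) ^ η * (1 - ‖(t : ℂ)‖ ^ 2) ^ η)) := by ring
      _ = _ := by rw [hN, hpow]
  have hmeas : ∀ n, Measurable fun t : Disk => f t * inner ℂ (e η n)
      (transport (groundProjection η) t (transport (groundProjection η) z (e η n))) := fun n => by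
    simp only [hform]
    have m1 := measurable_basicObservable hf
    have m2 : Measurable fun t : Disk => (((1 - ‖(t : ℂ)‖ ^ 2) ^ η : ℝ) : ℂ) :=
      Complex.measurable_ofReal.comp (by fun_prop)
    have m3 : Measurable fun t : Disk => U η z (e η 0) t :=
      (continuousOn_iff_continuous_domRestrict.1 (U η z (e η 0)).2.1.continuousOn).measurable
    have m4 : Measurable fun t : Disk => conj (t : ℂ) :=
      Complex.continuous_conj.measurable.comp measurable_subtype_coe
    fun_prop
  have hg : Integrable (fun t : Disk => (1 - ‖(t : ℂ)‖ ^ 2) ^ (2 * η - 1)) hypMeasure :=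
    integrable_one_sub_norm_sq_rpow (by linarith)
  have hint : ∀ n, Integrable (fun t : Disk => f t * inner ℂ (e η n)
      (transport (groundProjection η) t (transport (groundProjection η) z (e η n))))
        hypMeasure := fun n =>
    (hg.const_mul _).mono' (hmeas n).aestronglyMeasurable (Eventually.of_forall (hbound n))
  refine ⟨hint, Summable.of_nonneg_of_le (fun n => integral_nonneg fun _ => norm_nonneg _)
    (fun n => ?_) (((summable_normSqConst_mul_pow (η := η) (norm_nonneg _) hz).mul_left
      (K * D)).mul_right (∫ t : Disk, (1 - ‖(t : ℂ)‖ ^ 2) ^ (2 * η - 1) ∂hypMeasure))⟩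
  rw [← integral_const_mul]
  exact integral_mono (hint n).norm (hg.const_mul _) (hbound n)

end

end SU11

end

theorem mainTheorem3 (η : ℝ) [Fact (1 / 2 < η)] :
    (∀ (w₁ w₂ : ℝ → ℝ) (M₁ M₂ : SU11.FB η →L[ℂ] SU11.FB η),
      SU11.IsQuantizer w₁ M₁ → SU11.IsQuantizer w₂ M₂ →
      MeasureTheory.Integrable
        (fun t : SU11.Disk => SU11.k0 t * SU11.trace (SU11.transport M₁ t ∘L M₂))
        SU11.hypMeasure →
      ∃ ϰ : ℝ, ∀ f ∈ SU11.basicObservables, ∀ z : SU11.Disk,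
        MeasureTheory.Integrable (SU11.symbolIntegrand M₁ M₂ f z) SU11.hypMeasure ∧
        SU11.lowerSymbol M₁ M₂ f z = (ϰ : ℂ) * f z ∧
        (SU11.TraceConvergesAbsolutely M₁ M₂ f z →
          SU11.HasOperatorLowerSymbol M₁ M₂ f z ((ϰ : ℂ) * f z))) ∧
    (1 < η →
      (∃ M : SU11.FB η →L[ℂ] SU11.FB η, SU11.IsQuantizer (SU11.perelomovWeight η) M) ∧
      ∀ M : SU11.FB η →L[ℂ] SU11.FB η, SU11.IsQuantizer (SU11.perelomovWeight η) M →
        ∀ f ∈ SU11.basicObservables, ∀ z : SU11.Disk,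
          MeasureTheory.Integrable (SU11.symbolIntegrand M M f z) SU11.hypMeasure ∧
          SU11.lowerSymbol M M f z = ((η / (η - 1) : ℝ) : ℂ) * f z ∧
          SU11.HasOperatorLowerSymbol M M f z (((η / (η - 1) : ℝ) : ℂ) * f z)) := by
  refine ⟨fun w₁ w₂ M₁ M₂ h₁ h₂ hi => ?_, fun h1 => ⟨⟨_, SU11.isQuantizer_groundProjection⟩,
    fun M hM f hf z => ?_⟩⟩
  · have hconj := SU11.conj_symbolFactor (SU11.conj_overlap h₁.isDiagonal h₂.isDiagonal
      h₁.conj_inner h₂.conj_inner)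
    obtain ⟨ϰ, hϰ⟩ := Complex.conj_eq_iff_real.1 hconj
    refine ⟨ϰ, fun f hf z => ?_⟩
    have hl := SU11.lowerSymbol_eq h₁.isDiagonal h₂.isDiagonal h₂.traceClass hi hf z
    rw [hϰ] at hl
    exact ⟨SU11.integrable_symbolIntegrand h₁.isDiagonal h₂.traceClass hi hf z, hl,
      fun ht => hl ▸ SU11.hasOperatorLowerSymbol_lowerSymbol ht⟩
  · obtain rfl := hM.unique SU11.isQuantizer_groundProjection
    have hi := SU11.integrable_k0_mul_overlap_groundProjection h1
    have hl := SU11.lowerSymbol_eq hM.isDiagonal hM.isDiagonal hM.traceClass hi hf z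
    rw [SU11.symbolFactor_groundProjection h1] at hl
    exact ⟨SU11.integrable_symbolIntegrand hM.isDiagonal hM.traceClass hi hf z, hl,
      hl ▸ SU11.hasOperatorLowerSymbol_lowerSymbol
        (SU11.traceConvergesAbsolutely_groundProjection h1 hf z)⟩
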